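/- Let $X$ be a metric space and $A$ an abelian group. Definitions. An entourage is a set $E\subseteq X\times X$ with $\sup_{(x,y)\in E}d(x,y)<\infty$; put $E[B]=\{x : (x,y)\in E \text{ for some } y\in B\}$. A finite (possibly empty) family $V_1,\dots,V_n$ of subsets of $U\subseteq X$ is a coarse cover of $U$ if $\bigcap_i E[U\setminus V_i]$ is bounded for every entourage $E\subseteq U\times U$ (the empty intersection being $U$). The coarse site $X_{ct}$ is the poset of subsets of $X$ with the coarse covers as coverings. For $U\subseteq X$, $\check H^q_{ct}(U;A)$ denotes the $q$-th right derived functor of the section functor $F\mapsto F(U)$ on abelian sheaves on $X_{ct}$, applied to the constant sheaf $A$; restriction maps are derived from restriction of sections. A function $\varphi:U^{q+1}\to A$ is blocky if $U$ has a finite partition such that $\varphi$ is constant on all products of blocks. It has cocontrolled support if for each $R\ge 0$ the tuples $(x_0,\dots,x_q)$ with $\varphi(x_0,\dots,x_q)\ne 0$ and $d(x_i,x_j)\le R$ for all $i,j$ have bounded projections to every factor. Let $CY^q_b(U;A)$ be the group of blocky functions $U^{q+1}\to A$ modulo the blocky functions with cocontrolled support; with $(d\varphi)(x_0,\dots,x_{q+1})=\sum_i(-1)^i\varphi(x_0,\dots,\hat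 x_i,\dots,x_{q+1})$ these form a cochain complex, whose cohomology is denoted $HY^q_b(U;A)$. Theorem (Mayer–Vietoris). Let $U_1,U_2\subseteq X$ be a coarse cover of $X$. Then: (1) For every $q\ge 0$, $U\mapsto CY^q_b(U;A)$ is a sheaf on $X_{ct}$, and it is flabby: $CY^q_b(V;A)\to CY^q_b(U;A)$ is surjective whenever $U\subseteq V\subseteq X$. (2) For every $U\subseteq X$ and $q\ge 0$, $\check H^q_{ct}(U;A)$ is isomorphic to the $q$-th derived functor of global sections on the site $U_{ct}$ of the metric space $U$, applied to the constant sheaf $A$ on $U_{ct}$. (3) The sequence of cochain complexes $$0\to CY^*_b(X;A)\to CY^*_b(U_1;A)\oplus CY^*_b(U_2;A)\to CY^*_b(U_1\cap U_2;A)\to 0$$ with maps $\varphi\mapsto(\varphi|_{U_1},\varphi|_{U_2})$ and $(\varphi_1,\varphi_2)\mapsto\varphi_2|_{U_1\cap U_2}-\varphi_1|_{U_1\cap U_2}$ is short exact. (4) There are homomorphisms $\delta^q:\check H^q_{ct}(U_1\cap U_2;A)\to\check H^{q+1}_{ct}(X;A)$, $q\ge 0$, such that the sequence $$0\to\check H^0_{ct}(X;A)\to\check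 H^0_{ct}(U_1;A)\oplus\check H^0_{ct}(U_2;A)\to\check H^0_{ct}(U_1\cap U_2;A)\xrightarrow{\delta^0}\check H^1_{ct}(X;A)\to\cdots$$ $$\cdots\to\check H^q_{ct}(X;A)\to\check H^q_{ct}(U_1;A)\oplus\check H^q_{ct}(U_2;A)\to\check H^q_{ct}(U_1\cap U_2;A)\xrightarrow{\delta^q}\check H^{q+1}_{ct}(X;A)\to\cdots$$ is exact, where the unnamed maps are $x\mapsto(x|_{U_1},x|_{U_2})$ and $(y_1,y_2)\mapsto y_2|_{U_1\cap U_2}-y_1|_{U_1\cap U_2}$. Moreover there are isomorphisms $\check H^q_{ct}(U;A)\cong HY^q_b(U;A)$, natural in $U\subseteq X$, which identify every $\delta^q$ with the connecting homomorphism of the short exact sequence in (3). -/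

import Mathlib

open CategoryTheory Opposite

universe u

namespace CoarseMV

/-! ## The coarse site of a metric space -/

section Site

variable {X : Type u} [MetricSpace X]

/-- An entourage is a set of pairs of points of uniformly bounded distance. -/
def IsEntourage (E : Set (X × X)) : Prop :=
  ∃ R : ℝ, ∀ p ∈ E, dist p.1 p.2 ≤ R

/-- `E[B] = {x | (x, y) ∈ E for some y ∈ B}`. -/
def entourageNhd (E : Set (X × X)) (B : Set X) : Set X :=
  {x | ∃ y ∈ B, (x, y) ∈ E}

/-- The family `V` of subsets of `U` is a coarse cover of `U`. Complements and intersections are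
taken inside `U`; in particular the empty family covers `U` exactly if `U` is bounded. -/
def IsCoarseCover {ι : Type} (U : Set X) (V : ι → Set X) : Prop :=
  (∀ i, V i ⊆ U) ∧ ∀ E : Set (X × X), E ⊆ U ×ˢ U → IsEntourage E →
    Bornology.IsBounded (U ∩ ⋂ i, entourageNhd E (U \ V i))

theorem isCoarseCover_iff {ι : Type} (U : Set X) (V : ι → Set X) :
    IsCoarseCover U V ↔ (∀ i, V i ⊆ U) ∧ ∀ R : ℝ, 0 ≤ R →
      Bornology.IsBounded {x | x ∈ U ∧ ∀ i, ∃ y ∈ U, y ∉ V i ∧ dist x y ≤ R} := by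
  constructor
  · rintro ⟨h, H⟩
    refine ⟨h, fun R _ => ?_⟩
    refine (H {p | p ∈ U ×ˢ U ∧ dist p.1 p.2 ≤ R} (fun p hp => hp.1)
      ⟨R, fun p hp => hp.2⟩).subset ?_
    rintro x ⟨hxU, hx⟩
    refine ⟨hxU, Set.mem_iInter.2 fun i => ?_⟩
    obtain ⟨y, hyU, hyV, hd⟩ := hx i
    exact ⟨y, ⟨hyU, hyV⟩, ⟨hxU, hyU⟩, hd⟩
  · rintro ⟨h, H⟩
    refine ⟨h, fun E _ ⟨R, hR⟩ => ?_⟩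
    refine (H (max R 0) (le_max_right _ _)).subset ?_
    rintro x ⟨hxU, hx⟩
    refine ⟨hxU, fun i => ?_⟩
    obtain ⟨y, ⟨hyU, hyV⟩, hE⟩ := Set.mem_iInter.1 hx i
    exact ⟨y, hyU, hyV, (hR _ hE).trans (le_max_left _ _)⟩

variable (X)

/-- The coarse topology: a sieve on a subset `U` of `X` is covering if it contains all the members
of some finite coarse cover of `U`. -/
def coarseTopology : GrothendieckTopology (Set X) where
  sieves U := {S | ∃ (n : ℕ) (V : Fin n → Set X), IsCoarseCover U V ∧
    ∀ (i : Fin n) (h : V i ⊆ U), S.arrows (homOfLE h)}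
  top_mem' U := by
    refine ⟨1, fun _ => U, (isCoarseCover_iff _ _).2 ⟨fun _ => subset_rfl, fun R _ => ?_⟩,
      fun _ _ => trivial⟩
    refine Bornology.isBounded_empty.subset ?_
    rintro x ⟨-, hx⟩
    obtain ⟨y, hy, hy', -⟩ := hx 0
    exact hy' hy
  pullback_stable' U W S f := by
    rintro ⟨n, V, hV, hS⟩
    rw [isCoarseCover_iff] at hV
    have hWU : W ⊆ U := leOfHom f
    refine ⟨n, fun i => V i ∩ W, (isCoarseCover_iff _ _).2
      ⟨fun _ => Set.inter_subset_right, fun R hR => ?_⟩, fun i h => ?_⟩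
    · refine (hV.2 R hR).subset ?_
      rintro x ⟨hxW, hx⟩
      refine ⟨hWU hxW, fun i => ?_⟩
      obtain ⟨y, hyW, hy, hd⟩ := hx i
      exact ⟨y, hWU hyW, fun h => hy ⟨h, hyW⟩, hd⟩
    · exact S.downward_closed (hS i (hV.1 i))
        (homOfLE (Set.inter_subset_left : V i ∩ W ⊆ V i))
  transitive' U S := by
    rintro ⟨n, V, hV, hS⟩ R hR
    rw [isCoarseCover_iff] at hV
    choose m W hW hWR using fun i => hR (hS i (hV.1 i))
    simp only [isCoarseCover_iff] at hW
    let e := finSigmaFinEquiv (m := n) (n := m)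
    refine ⟨∑ i, m i, fun k => W (e.symm k).1 (e.symm k).2, (isCoarseCover_iff _ _).2
      ⟨fun k => ((hW _).1 _).trans (hV.1 _), fun r hr => ?_⟩, fun k h => ?_⟩
    · refine ((hV.2 r hr).union
        ((Bornology.isBounded_iUnion).2 fun i => (hW i).2 r hr)).subset ?_
      rintro x ⟨hxU, hx⟩
      by_cases hc : ∀ i, ∃ y ∈ U, y ∉ V i ∧ dist x y ≤ r
      · exact Or.inl ⟨hxU, hc⟩
      · push Not at hc
        obtain ⟨i, hi⟩ := hc
        have key : ∀ y ∈ U, dist x y ≤ r → y ∈ V i := fun y hy hd => by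
          by_contra hn
          exact absurd (hi y hy hn) (not_lt.2 hd)
        refine Or.inr (Set.mem_iUnion.2 ⟨i, key x hxU (by simpa using hr), fun j => ?_⟩)
        obtain ⟨y, hyU, hyW, hd⟩ := hx (e ⟨i, j⟩)
        rw [Equiv.symm_apply_apply] at hyW
        exact ⟨y, key y hyU hd, hyW, hd⟩
    · exact hWR (e.symm k).1 (e.symm k).2 ((hW _).1 _)

end Site

/-! ## Coarse sheaf cohomology with constant coefficients -/

section SheafCohomology

variable (X : Type u) [MetricSpace X] (A : Type u) [AddCommGroup A]

/-- The constant sheaf `A` on the coarse site of `X`. -/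
noncomputable def coarseConstantSheaf : Sheaf (coarseTopology X) AddCommGrpCat.{u} :=
  (constantSheaf (coarseTopology X) AddCommGrpCat.{u}).obj (AddCommGrpCat.of A)

instance sheafSections_additive (U : (Set X)ᵒᵖ) :
    ((sheafSections (coarseTopology X) AddCommGrpCat.{u}).obj U).Additive where
  map_add := rfl

/-- `U ↦ H^q(U; A)`: the `q`-th right derived functor of the section functor `F ↦ F(U)` on abelian
sheaves on the coarse site of `X`, applied to the constant sheaf `A`. A restriction map is the one
derived from the restriction of sections. For `U = X` this is the `q`-th right derived functor
of the global section functor. -/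
noncomputable def coarseSheafCohomology (q : ℕ) : (Set X)ᵒᵖ ⥤ AddCommGrpCat.{u} where
  obj U := (((sheafSections (coarseTopology X) AddCommGrpCat.{u}).obj U).rightDerived q).obj
    (coarseConstantSheaf X A)
  map f := (NatTrans.rightDerived
    ((sheafSections (coarseTopology X) AddCommGrpCat.{u}).map f) q).app (coarseConstantSheaf X A)
  map_id U := by
    rw [CategoryTheory.Functor.map_id, NatTrans.rightDerived_id]; rfl
  map_comp f g := by
    rw [CategoryTheory.Functor.map_comp, NatTrans.rightDerived_comp]; rfl

end SheafCohomology

/-! ## Blocky cochains -/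

section Cochains

set_option linter.unusedSectionVars false

variable {Y : Type u} [MetricSpace Y] {Z : Type u} [MetricSpace Z] {W : Type u} [MetricSpace W]
  {A : Type u} [AddCommGroup A]

/-- `φ` is blocky: there is a finite partition of `Y` (into the fibres of `b`) such that `φ` is
constant on all products of blocks. -/
def IsBlocky {q : ℕ} (φ : (Fin (q + 1) → Y) → A) : Prop :=
  ∃ (n : ℕ) (b : Y → Fin n), ∀ x y : Fin (q + 1) → Y, (∀ i, b (x i) = b (y i)) → φ x = φ y

/-- A set `C` of `q`-simplices is cocontrolled: for every `R`, all the coordinates of the simplices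
in `C` of diameter at most `R` form a bounded set. -/
def IsCocontrolled {q : ℕ} (C : Set (Fin (q + 1) → Y)) : Prop :=
  ∀ R : ℝ, ∀ i, Bornology.IsBounded
    ((fun x : Fin (q + 1) → Y => x i) '' {x | x ∈ C ∧ ∀ j k, dist (x j) (x k) ≤ R})

theorem IsBlocky.map₂ {q : ℕ} {φ ψ : (Fin (q + 1) → Y) → A} (hφ : IsBlocky φ) (hψ : IsBlocky ψ)
    (g : A → A → A) : IsBlocky (fun x => g (φ x) (ψ x)) := by
  obtain ⟨n, b, hb⟩ := hφ
  obtain ⟨m, c, hc⟩ := hψ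
  refine ⟨n * m, fun x => finProdFinEquiv (b x, c x), fun x y h => ?_⟩
  have h' : ∀ i, b (x i) = b (y i) ∧ c (x i) = c (y i) := fun i => by
    simpa using h i
  exact congrArg₂ g (hb x y fun i => (h' i).1) (hc x y fun i => (h' i).2)

theorem isBlocky_const {q : ℕ} (a : A) : IsBlocky (fun _ : Fin (q + 1) → Y => a) :=
  ⟨1, fun _ => 0, fun _ _ _ => rfl⟩

theorem IsCocontrolled.mono {q : ℕ} {C D : Set (Fin (q + 1) → Y)} (hD : IsCocontrolled D)
    (h : C ⊆ D) : IsCocontrolled C := fun R i =>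
  (hD R i).subset (Set.image_mono fun _ hx => ⟨h hx.1, hx.2⟩)

theorem IsCocontrolled.union {q : ℕ} {C D : Set (Fin (q + 1) → Y)} (hC : IsCocontrolled C)
    (hD : IsCocontrolled D) : IsCocontrolled (C ∪ D) := fun R i => by
  refine ((hC R i).union (hD R i)).subset ?_
  rintro _ ⟨x, ⟨hx | hx, hR⟩, rfl⟩
  · exact Or.inl ⟨x, ⟨hx, hR⟩, rfl⟩
  · exact Or.inr ⟨x, ⟨hx, hR⟩, rfl⟩

variable (Y A)

/-- The group `C^q(Y; A)` of blocky functions `Y^{q+1} → A`. -/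
def blockyCochains (q : ℕ) : AddSubgroup ((Fin (q + 1) → Y) → A) where
  carrier := {φ | IsBlocky φ}
  zero_mem' := isBlocky_const 0
  add_mem' h h' := h.map₂ h' (fun a b => a + b)
  neg_mem' h := h.map₂ h (fun a _ => -a)

/-- The subgroup `CX_b^q(Y; A)` of blocky functions with cocontrolled support. -/
def cocontrolledCochains (q : ℕ) : AddSubgroup ((Fin (q + 1) → Y) → A) where
  carrier := {φ | IsBlocky φ ∧ IsCocontrolled {x | φ x ≠ 0}}
  zero_mem' := ⟨isBlocky_const 0, fun R i => by simp⟩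
  add_mem' {φ ψ} h h' := ⟨h.1.map₂ h'.1 (fun a b => a + b), (h.2.union h'.2).mono fun x hx => by
    by_contra hn
    simp only [Set.mem_union, Set.mem_ofPred_eq, not_or, not_not] at hn
    exact hx (by simp [hn.1, hn.2])⟩
  neg_mem' {φ} h := ⟨h.1.map₂ h.1 (fun a _ => -a), h.2.mono fun x hx => by simpa using hx⟩

/-- `CY_b^q(Y; A) = C^q(Y; A) / CX_b^q(Y; A)`. -/
abbrev CoarseCochains (q : ℕ) : Type u :=
  blockyCochains Y A q ⧸ (cocontrolledCochains Y A q).addSubgroupOf (blockyCochains Y A q)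

variable {Y A}

/-- The homomorphism `CY_b^p(Y; A) → CY_b^q(Z; A)` induced by a homomorphism `T` of groups of
functions which respects blocky functions and blocky functions with cocontrolled support. -/
def coarseCochainsMap {p q : ℕ} (T : ((Fin (p + 1) → Y) → A) →+ ((Fin (q + 1) → Z) → A))
    (hB : ∀ φ ∈ blockyCochains Y A p, T φ ∈ blockyCochains Z A q)
    (hX : ∀ φ ∈ cocontrolledCochains Y A p, T φ ∈ cocontrolledCochains Z A q) :
    CoarseCochains Y A p →+ CoarseCochains Z A q :=
  QuotientAddGroup.map _ _
    ((T.comp (blockyCochains Y A p).subtype).codRestrict (blockyCochains Z A q)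
      fun φ => hB φ φ.2)
    (fun φ hφ => hX φ hφ)

/-- The coboundary `(dφ)(x₀, …, x_{q+1}) = ∑ᵢ (-1)^i φ(x₀, …, x̂ᵢ, …, x_{q+1})` on functions. -/
def coboundaryFun (q : ℕ) : ((Fin (q + 1) → Y) → A) →+ ((Fin (q + 2) → Y) → A) where
  toFun φ x := ∑ i : Fin (q + 2), (-1 : ℤ) ^ (i : ℕ) • φ (fun j => x (i.succAbove j))
  map_zero' := by ext x; simp
  map_add' φ ψ := by ext x; simp [Finset.sum_add_distrib]

theorem coboundaryFun_apply (q : ℕ) (φ : (Fin (q + 1) → Y) → A) (x : Fin (q + 2) → Y) :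
    coboundaryFun q φ x =
      ∑ i : Fin (q + 2), (-1 : ℤ) ^ (i : ℕ) • φ (fun j => x (i.succAbove j)) := rfl

theorem coboundaryFun_mem_blocky (q : ℕ) (φ : (Fin (q + 1) → Y) → A)
    (hφ : φ ∈ blockyCochains Y A q) : coboundaryFun q φ ∈ blockyCochains Y A (q + 1) := by
  obtain ⟨n, b, hb⟩ := hφ
  refine ⟨n, b, fun x y h => ?_⟩
  simp only [coboundaryFun_apply]
  refine Finset.sum_congr rfl fun i _ => ?_
  rw [hb _ (fun j => y (i.succAbove j)) fun j => h _]

theorem coboundaryFun_mem_cocontrolled (q : ℕ) (φ : (Fin (q + 1) → Y) → A)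
    (hφ : φ ∈ cocontrolledCochains Y A q) :
    coboundaryFun q φ ∈ cocontrolledCochains Y A (q + 1) := by
  refine ⟨coboundaryFun_mem_blocky q φ hφ.1, fun R i => ?_⟩
  have hb : Bornology.IsBounded (⋃ j : Fin (q + 1),
      (fun x : Fin (q + 1) → Y => x j) '' {x | φ x ≠ 0 ∧ ∀ j k, dist (x j) (x k) ≤ R}) :=
    Bornology.isBounded_iUnion.2 fun j => hφ.2 R j
  refine (hb.cthickening (δ := R)).subset ?_
  rintro _ ⟨x, ⟨hx, hR⟩, rfl⟩
  have hx' : coboundaryFun q φ x ≠ 0 := hx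
  rw [coboundaryFun_apply] at hx'
  obtain ⟨k, -, hk⟩ := Finset.exists_ne_zero_of_sum_ne_zero hx'
  have hk' : φ (fun j => x (k.succAbove j)) ≠ 0 := fun h => hk (by rw [h, smul_zero])
  refine Metric.mem_cthickening_of_dist_le _ (x (k.succAbove 0)) _ _
    (Set.mem_iUnion.2 ⟨0, _, ⟨hk', fun _ _ => hR _ _⟩, rfl⟩) (hR _ _)

theorem coboundaryFun_coboundaryFun (q : ℕ) (φ : (Fin (q + 1) → Y) → A) :
    coboundaryFun (q + 1) (coboundaryFun q φ) = 0 := by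
  ext x
  simp only [coboundaryFun_apply, Pi.zero_apply, Finset.smul_sum, smul_smul]
  rw [Finset.sum_sigma']
  refine Finset.sum_involution (fun p _ => ⟨p.1.succAbove p.2, p.2.predAbove p.1⟩) ?_ ?_
    (fun _ _ => Finset.mem_univ _) ?_
  · rintro ⟨i, j⟩ -
    have h : (fun k => x ((i.succAbove j).succAbove ((j.predAbove i).succAbove k))) =
        fun k => x (i.succAbove (j.succAbove k)) :=
      funext fun k => by rw [Fin.succAbove_succAbove_succAbove_predAbove]
    simp only [h, ← pow_add, Fin.neg_one_pow_succAbove_add_predAbove, neg_smul, add_neg_cancel]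
  · rintro ⟨i, j⟩ - - h
    exact Fin.succAbove_ne i j (congrArg Sigma.fst h)
  · rintro ⟨i, j⟩ -
    simp [Fin.succAbove_succAbove_predAbove, Fin.predAbove_predAbove_succAbove]

/-- Pullback of functions along a map `f`, on `(q + 1)`-tuples. -/
def pullbackFun (f : Z → Y) (q : ℕ) : ((Fin (q + 1) → Y) → A) →+ ((Fin (q + 1) → Z) → A) where
  toFun φ x := φ (fun j => f (x j))
  map_zero' := rfl
  map_add' _ _ := rfl

theorem pullbackFun_mem_blocky (f : Z → Y) (q : ℕ) (φ : (Fin (q + 1) → Y) → A)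
    (hφ : φ ∈ blockyCochains Y A q) : pullbackFun f q φ ∈ blockyCochains Z A q := by
  obtain ⟨n, b, hb⟩ := hφ
  exact ⟨n, fun z => b (f z), fun x y h => hb _ _ h⟩

theorem pullbackFun_mem_cocontrolled {f : Z → Y} (hf : Isometry f) (q : ℕ)
    (φ : (Fin (q + 1) → Y) → A) (hφ : φ ∈ cocontrolledCochains Y A q) :
    pullbackFun f q φ ∈ cocontrolledCochains Z A q := by
  refine ⟨pullbackFun_mem_blocky f q φ hφ.1, fun R i => ?_⟩
  refine (hf.antilipschitz.isBounded_preimage (hφ.2 R i)).subset ?_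
  rintro _ ⟨x, ⟨hx, hR⟩, rfl⟩
  exact ⟨fun j => f (x j), ⟨hx, fun j k => by rw [hf.dist_eq]; exact hR j k⟩, rfl⟩

variable (Y A)

/-- The cochain complex `CY_b^*(Y; A)`. -/
def coarseCochainComplex : CochainComplex AddCommGrpCat.{u} ℕ :=
  CochainComplex.of (fun q => AddCommGrpCat.of (CoarseCochains Y A q))
    (fun q => AddCommGrpCat.ofHom (coarseCochainsMap (coboundaryFun q)
      (coboundaryFun_mem_blocky q) (coboundaryFun_mem_cocontrolled q)))
    (fun q => by
      ext φ
      refine congrArg (QuotientAddGroup.mk (s := (cocontrolledCochains Y A (q + 2)).addSubgroupOf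
        (blockyCochains Y A (q + 2)))) (Subtype.ext ?_)
      exact coboundaryFun_coboundaryFun q φ.1)

end Cochains

section Presheaf

variable (X : Type u) [MetricSpace X] (A : Type u) [AddCommGroup A]

theorem isometry_inclusion {X : Type u} [MetricSpace X] {U V : Set X} (h : U ⊆ V) :
    Isometry (Set.inclusion h) := fun _ _ => rfl

/-- The presheaf of cochain complexes `U ↦ CY_b^*(U; A)` on the subsets of `X`, with the restriction
of functions as restriction maps. -/
def coarseCochainPresheaf : (Set X)ᵒᵖ ⥤ CochainComplex AddCommGrpCat.{u} ℕ where
  obj U := coarseCochainComplex (↥U.unop) A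
  map {U V} f :=
    { f := fun q => AddCommGrpCat.ofHom (coarseCochainsMap
        (pullbackFun (Set.inclusion (leOfHom f.unop)) q)
        (pullbackFun_mem_blocky _ q)
        (pullbackFun_mem_cocontrolled (isometry_inclusion (leOfHom f.unop)) q))
      comm' := by
        rintro i _ rfl
        simp only [coarseCochainComplex, CochainComplex.of_d]
        ext φ
        refine congrArg (QuotientAddGroup.mk (s := (cocontrolledCochains _ A (i + 1)).addSubgroupOf
          (blockyCochains _ A (i + 1)))) (Subtype.ext ?_)
        rfl }
  map_id U := by
    ext q φ
    obtain ⟨φ, rfl⟩ := QuotientAddGroup.mk_surjective φ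
    rfl
  map_comp f g := by
    ext q φ
    obtain ⟨φ, rfl⟩ := QuotientAddGroup.mk_surjective φ
    rfl

/-- The sequence of cochain complexes
`CY_b^*(X; A) ⟶ CY_b^*(U₁; A) ⊕ CY_b^*(U₂; A) ⟶ CY_b^*(U₁ ∩ U₂; A)` with the maps
`φ ↦ (φ|_{U₁}, φ|_{U₂})` and `(φ₁, φ₂) ↦ φ₂|_{U₁ ∩ U₂} - φ₁|_{U₁ ∩ U₂}`. -/
noncomputable def mayerVietorisShortComplex (U₁ U₂ : Set X) :
    ShortComplex (CochainComplex AddCommGrpCat.{u} ℕ) where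
  X₁ := (coarseCochainPresheaf X A).obj (op Set.univ)
  X₂ := (coarseCochainPresheaf X A).obj (op U₁) ⊞ (coarseCochainPresheaf X A).obj (op U₂)
  X₃ := (coarseCochainPresheaf X A).obj (op (U₁ ∩ U₂))
  f := Limits.biprod.lift
    ((coarseCochainPresheaf X A).map (homOfLE (Set.subset_univ U₁)).op)
    ((coarseCochainPresheaf X A).map (homOfLE (Set.subset_univ U₂)).op)
  g := Limits.biprod.desc
    (-(coarseCochainPresheaf X A).map
      (homOfLE (Set.inter_subset_left : U₁ ∩ U₂ ⊆ U₁)).op)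
    ((coarseCochainPresheaf X A).map
      (homOfLE (Set.inter_subset_right : U₁ ∩ U₂ ⊆ U₂)).op)
  zero := by
    rw [Limits.biprod.lift_desc, Preadditive.comp_neg, ← Functor.map_comp, ← Functor.map_comp,
      ← op_comp, ← op_comp]
    exact neg_add_cancel _

end Presheaf

/-! ## The maps of the Mayer–Vietoris sequence -/

section Maps

variable (X : Type u) [MetricSpace X] (A : Type u) [AddCommGroup A]

/-- The restriction `H^q(V; A) → H^q(U; A)` for `U ⊆ V`. -/
noncomputable def cohomologyRestrict (q : ℕ) {U V : Set X} (h : U ⊆ V) :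
    (coarseSheafCohomology X A q).obj (op V) →+ (coarseSheafCohomology X A q).obj (op U) :=
  ((coarseSheafCohomology X A q).map (homOfLE h).op).hom

/-- `H^q(X; A) → H^q(U₁; A) ⊕ H^q(U₂; A)`, `x ↦ (x|_{U₁}, x|_{U₂})`. -/
noncomputable def mayerVietorisRestrict (q : ℕ) (U₁ U₂ : Set X) :
    (coarseSheafCohomology X A q).obj (op Set.univ) →+
      (coarseSheafCohomology X A q).obj (op U₁) × (coarseSheafCohomology X A q).obj (op U₂) :=
  (cohomologyRestrict X A q (Set.subset_univ U₁)).prod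
    (cohomologyRestrict X A q (Set.subset_univ U₂))

/-- `H^q(U₁; A) ⊕ H^q(U₂; A) → H^q(U₁ ∩ U₂; A)`,
`(y₁, y₂) ↦ y₂|_{U₁ ∩ U₂} - y₁|_{U₁ ∩ U₂}`. -/
noncomputable def mayerVietorisDiff (q : ℕ) (U₁ U₂ : Set X) :
    (coarseSheafCohomology X A q).obj (op U₁) × (coarseSheafCohomology X A q).obj (op U₂) →+
      (coarseSheafCohomology X A q).obj (op (U₁ ∩ U₂)) :=
  (cohomologyRestrict X A q (Set.inter_subset_right : U₁ ∩ U₂ ⊆ U₂)).comp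
      (AddMonoidHom.snd _ _) -
    (cohomologyRestrict X A q (Set.inter_subset_left : U₁ ∩ U₂ ⊆ U₁)).comp
      (AddMonoidHom.fst _ _)

end Maps

end CoarseMV

/-! The complexes `CY_b^*` form a flabby resolution of the constant sheaf, so their sections compute
sheaf cohomology; the rest is formal. The sheaf property is a statement about supports: for a fixed
coarse cover, the simplices of diameter at most `R` that lie in no member have all their vertices in
a common bounded set, hence are invisible modulo cocontrolled support. Flabbiness is extension by
zero. That the complex resolves `A` rests on `exists_cover_eq_zero`: a blocky function with
cocontrolled support vanishes identically on the members of a suitable coarse cover. A cocycle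
modulo cocontrolled support is therefore locally a cocycle of functions, and the cone from a point
makes it a coboundary, or in degree zero a constant.

Flabby resolutions compute cohomology for the usual reason, but coverings are finite, so no
transfinite extension is needed: a coarse cover splits into successive covers by two sets
(`IsCoarseCover.exists_split`), and local primitives are glued two at a time
(`exact_sections_of_flabby`). Applied to the mapping fibre of a morphism from `CY_b^*` to an
injective resolution, whose terms are flabby as well, this gives isomorphisms on the cohomology of
sections over every subset, compatible with restriction.

The short exact sequence is the sheaf condition for two sets together with flabbiness; its long
exact sequence is transported to sheaf cohomology. The two cohomologies of a subset agree because
both are computed by the same cochains, so the two sites are never compared directly. -/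

namespace CoarseMV

/-! ### Reduction of coarse covers to covers by two sets -/

section SitePrinciples

variable {X : Type u} [MetricSpace X]

theorem IsCoarseCover.subset {ι : Type} {U : Set X} {V : ι → Set X} (hV : IsCoarseCover U V)
    (i : ι) : V i ⊆ U :=
  hV.1 i

theorem IsCoarseCover.left_subset {U V₁ V₂ : Set X} (hV : IsCoarseCover U ![V₁, V₂]) : V₁ ⊆ U :=
  hV.1 0

theorem IsCoarseCover.right_subset {U V₁ V₂ : Set X} (hV : IsCoarseCover U ![V₁, V₂]) : V₂ ⊆ U :=
  hV.1 1

theorem isCoarseCover_pair_iff (U V₁ V₂ : Set X) :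
    IsCoarseCover U ![V₁, V₂] ↔ V₁ ⊆ U ∧ V₂ ⊆ U ∧ ∀ R : ℝ, 0 ≤ R →
      Bornology.IsBounded {x | x ∈ U ∧ (∃ y ∈ U, y ∉ V₁ ∧ dist x y ≤ R) ∧
        ∃ y ∈ U, y ∉ V₂ ∧ dist x y ≤ R} := by
  simp [isCoarseCover_iff, Fin.forall_fin_two, and_assoc]

theorem IsCoarseCover.inter {ι : Type} {U : Set X} {V : ι → Set X} (hV : IsCoarseCover U V)
    {W : Set X} (hW : W ⊆ U) : IsCoarseCover W (fun i => V i ∩ W) := by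
  rw [isCoarseCover_iff] at hV ⊢
  refine ⟨fun _ => Set.inter_subset_right, fun R hR => (hV.2 R hR).subset ?_⟩
  rintro x ⟨hxW, hx⟩
  refine ⟨hW hxW, fun i => ?_⟩
  obtain ⟨y, hyW, hy, hd⟩ := hx i
  exact ⟨y, hW hyW, fun h => hy ⟨h, hyW⟩, hd⟩

theorem isCoarseCover_zero {U : Set X} (hU : Bornology.IsBounded U) (V : Fin 0 → Set X) :
    IsCoarseCover U V :=
  ⟨fun i => i.elim0, fun _ _ _ => hU.subset Set.inter_subset_left⟩

/-- A coarse cover by `n + 1` sets decomposes into a coarse cover by two sets and a coarse cover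
by `n` sets. -/
theorem IsCoarseCover.exists_split {n : ℕ} {U : Set X} {V : Fin (n + 1) → Set X}
    (hV : IsCoarseCover U V) : ∃ W : Set X, IsCoarseCover U ![V 0, W] ∧
      IsCoarseCover W (fun i : Fin n => V i.succ ∩ W) := by
  rw [isCoarseCover_iff] at hV
  simp only [Fin.forall_fin_succ] at hV
  obtain ⟨⟨h0, hs⟩, hb⟩ := hV
  -- The witness consists of the points at least as close to the complement of `V 0` as to the
  -- farthest of the other complements. Inside it, being near all the other complements forces being
  -- near that of `V 0`; outside it, being near the complement of `V 0` forces being near all the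
  -- others.
  refine ⟨{x | x ∈ U ∧ ∀ r : ℝ, 0 ≤ r → (∀ i : Fin n, ∃ y ∈ U, y ∉ V i.succ ∧ dist x y ≤ r) →
    ∃ y ∈ U, y ∉ V 0 ∧ dist x y ≤ r}, (isCoarseCover_pair_iff _ _ _).2 ⟨h0, fun x hx => hx.1,
      fun R hR => ?_⟩, (isCoarseCover_iff _ _).2 ⟨fun _ => Set.inter_subset_right,
      fun R hR => (hb R hR).subset ?_⟩⟩
  -- The bound applies to the point `y` outside the witness rather than to `x`: `y` is within `2 *
  -- R` of `z`, hence of all the complements, and `x` is within `R` of `y`.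
  · refine ((hb (2 * R) (by positivity)).cthickening (δ := R)).subset ?_
    rintro x ⟨hxU, ⟨z, hzU, hz0, hxz⟩, y, hyU, hy, hxy⟩
    refine Metric.mem_cthickening_of_dist_le x y _ _ ?_ hxy
    have hyz : dist y z ≤ 2 * R := by
      have := dist_triangle_left y z x
      linarith
    refine ⟨hyU, ⟨z, hzU, hz0, hyz⟩, ?_⟩
    simp only [Set.mem_ofPred_eq, not_and, not_forall] at hy
    obtain ⟨r, hr, hyr, hyn⟩ := hy hyU
    have hlt : r < 2 * R := by
      by_contra hle
      exact hyn ⟨z, hzU, hz0, hyz.trans (not_lt.1 hle)⟩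
    intro i
    obtain ⟨w, hwU, hw, hd⟩ := hyr i
    exact ⟨w, hwU, hw, hd.trans hlt.le⟩
  · rintro x ⟨hxW, hx⟩
    have key : ∀ i : Fin n, ∃ y ∈ U, y ∉ V i.succ ∧ dist x y ≤ R := fun i => by
      obtain ⟨y, hyW, hy, hd⟩ := hx i
      exact ⟨y, hyW.1, fun h => hy ⟨h, hyW⟩, hd⟩
    exact ⟨hxW.1, hxW.2 R hR key, key⟩

/-- A property of subsets of `U` which passes to smaller sets, holds for bounded sets and is
inherited along coarse covers by two sets holds for `U` if it holds locally. -/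
theorem coarse_induction {U : Set X} (P : Set X → Prop)
    (mono : ∀ V W : Set X, V ⊆ W → P W → P V)
    (bdd : ∀ V ⊆ U, Bornology.IsBounded V → P V)
    (pair : ∀ W ⊆ U, ∀ V₁ V₂ : Set X, IsCoarseCover W ![V₁, V₂] → P V₁ → P V₂ → P W)
    {S : Sieve U} (hS : S ∈ coarseTopology X U) (h : ∀ (V : Set X) (f : V ⟶ U), S f → P V) :
    P U := by
  obtain ⟨n, V, hV, hSV⟩ := hS
  -- The statement is for all `W ⊆ U`, because each split passes to a smaller set. When no member is
  -- left, that set is bounded.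
  have key : ∀ (n : ℕ) (W : Set X), W ⊆ U → ∀ V : Fin n → Set X, IsCoarseCover W V →
      (∀ i, P (V i)) → P W := by
    intro n
    induction n with
    | zero =>
      intro W hW V hV _
      refine bdd W hW ?_
      have := (((isCoarseCover_iff _ _).1 hV).2 0 le_rfl)
      exact this.subset fun x hx => ⟨hx, fun i => i.elim0⟩
    | succ n ih =>
      intro W hW V hV hP
      obtain ⟨W', h2, hn⟩ := hV.exists_split
      have hW' : W' ⊆ W := h2.right_subset
      exact pair W hW _ _ h2 (hP 0) (ih W' (hW'.trans hW) _ hn fun i =>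
        mono _ _ Set.inter_subset_left (hP i.succ))
  exact key n U subset_rfl V hV fun i => h _ _ (hSV i (hV.1 i))

end SitePrinciples

/-! ### Sheaves on the coarse site and acyclicity of flabby sheaves -/

section Presheaves

variable {X : Type u}

/-- Restriction of sections of a presheaf of abelian groups on the subsets of `X`. -/
def res (P : (Set X)ᵒᵖ ⥤ AddCommGrpCat.{u}) {U V : Set X} (h : U ⊆ V) :
    P.obj (op V) →+ P.obj (op U) :=
  (P.map (homOfLE h).op).hom

/-- The action of a morphism of presheaves on sections. -/
def onSections {P Q : (Set X)ᵒᵖ ⥤ AddCommGrpCat.{u}} (f : P ⟶ Q) (U : Set X) :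
    P.obj (op U) →+ Q.obj (op U) :=
  (f.app (op U)).hom

@[simp]
theorem res_self (P : (Set X)ᵒᵖ ⥤ AddCommGrpCat.{u}) {U : Set X} (h : U ⊆ U)
    (s : P.obj (op U)) : res P h s = s := by
  change (P.map (𝟙 (op U))).hom s = s
  simp

@[simp]
theorem res_res (P : (Set X)ᵒᵖ ⥤ AddCommGrpCat.{u}) {U V W : Set X} (h : U ⊆ V) (h' : V ⊆ W)
    (s : P.obj (op W)) : res P h (res P h' s) = res P (h.trans h') s := by
  change (P.map (homOfLE h').op ≫ P.map (homOfLE h).op).hom s = _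
  rw [← P.map_comp]
  rfl

theorem onSections_res {P Q : (Set X)ᵒᵖ ⥤ AddCommGrpCat.{u}} (f : P ⟶ Q) {U V : Set X}
    (h : U ⊆ V) (s : P.obj (op V)) : onSections f U (res P h s) = res Q h (onSections f V s) :=
  congrArg (fun g => g.hom s) (f.naturality (homOfLE h).op)

/-- The restriction maps of a flabby presheaf are surjective. -/
def IsFlabby (P : (Set X)ᵒᵖ ⥤ AddCommGrpCat.{u}) : Prop :=
  ∀ ⦃U V : Set X⦄ (h : U ⊆ V), Function.Surjective (res P h)

variable [MetricSpace X]

/-- The sheaf condition for finite coarse covers. -/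
structure HasCoarseGluing (P : (Set X)ᵒᵖ ⥤ AddCommGrpCat.{u}) : Prop where
  eq_zero : ∀ ⦃n : ℕ⦄ ⦃U : Set X⦄ ⦃V : Fin n → Set X⦄ (hV : IsCoarseCover U V)
    (s : P.obj (op U)), (∀ i, res P (hV.subset i) s = 0) → s = 0
  glue : ∀ ⦃n : ℕ⦄ ⦃U : Set X⦄ ⦃V : Fin n → Set X⦄ (hV : IsCoarseCover U V)
    (s : ∀ i, P.obj (op (V i))), (∀ i j, res P (Set.inter_subset_left : V i ∩ V j ⊆ V i) (s i) =
      res P (Set.inter_subset_right : V i ∩ V j ⊆ V j) (s j)) →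
    ∃ t : P.obj (op U), ∀ i, res P (hV.subset i) t = s i

/-- A presheaf with the sheaf condition for finite coarse covers is a sheaf. -/
theorem HasCoarseGluing.isSheaf {P : (Set X)ᵒᵖ ⥤ AddCommGrpCat.{u}} (hP : HasCoarseGluing P) :
    Presheaf.IsSheaf (coarseTopology X) P := by
  rw [Presheaf.isSheaf_iff_isSheaf_forget (coarseTopology X) P (forget AddCommGrpCat.{u}),
    isSheaf_iff_isSheaf_of_type]
  rintro U S ⟨n, V, hV, hS⟩ x hx
  let y : ∀ (W : Set X) (h : W ⊆ U), S (homOfLE h) → P.obj (op W) := fun W h hW =>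
    x (homOfLE h) hW
  have hres : ∀ (W W' : Set X) (h : W ⊆ U) (h' : W' ⊆ W) (hW : S (homOfLE h))
      (hW' : S (homOfLE (h'.trans h))), res P h' (y W h hW) = y W' (h'.trans h) hW' := by
    intro W W' h h' hW hW'
    exact ((Presieve.compatible_iff_sieveCompatible x).1 hx (homOfLE h) (homOfLE h') hW).symm
  have hy : ∀ i j, res P (Set.inter_subset_left : V i ∩ V j ⊆ V i) (y _ _ (hS i (hV.subset i))) =
      res P (Set.inter_subset_right : V i ∩ V j ⊆ V j) (y _ _ (hS j (hV.subset j))) := by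
    intro i j
    have hij : S (homOfLE (Set.inter_subset_left.trans (hV.subset i) : V i ∩ V j ⊆ U)) :=
      S.downward_closed (hS i (hV.subset i)) (homOfLE (Set.inter_subset_left : V i ∩ V j ⊆ V i))
    rw [hres _ _ _ _ _ hij, hres _ _ _ _ _ hij]
  obtain ⟨t, ht⟩ := hP.glue hV _ hy
  refine ⟨t, ?_, ?_⟩
  · intro W f hf
    have hWU : W ⊆ U := leOfHom f
    replace hf : S (homOfLE hWU) := hf
    change res P hWU t = y W hWU hf
    rw [← sub_eq_zero]
    -- `W` need not lie in a single member, so the comparison is made on the induced cover of `W` by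
    -- the sets `V i ∩ W`.
    refine hP.eq_zero (hV.inter hWU) _ fun i => ?_
    have hi : S (homOfLE (Set.inter_subset_right.trans hWU : V i ∩ W ⊆ U)) :=
      S.downward_closed hf (homOfLE (Set.inter_subset_right : V i ∩ W ⊆ W))
    rw [map_sub, res_res, hres _ _ _ _ _ hi, sub_eq_zero,
      ← hres (V i) (V i ∩ W) (hV.subset i) Set.inter_subset_left (hS i (hV.subset i)) hi, ← ht i, res_res]
  · intro (t' : P.obj (op U)) ht'
    change t' = t
    rw [← sub_eq_zero]
    refine hP.eq_zero hV _ fun i => ?_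
    rw [map_sub, ht i, sub_eq_zero]
    exact ht' _ (hS i (hV.subset i))

/-- A sheaf satisfies the sheaf condition for finite coarse covers. -/
theorem hasCoarseGluing_of_isSheaf {P : (Set X)ᵒᵖ ⥤ AddCommGrpCat.{u}}
    (hP : Presheaf.IsSheaf (coarseTopology X) P) : HasCoarseGluing P := by
  rw [Presheaf.isSheaf_iff_isSheaf_forget (coarseTopology X) P (forget AddCommGrpCat.{u}),
    isSheaf_iff_isSheaf_of_type] at hP
  have hmem : ∀ {n : ℕ} {U : Set X} {V : Fin n → Set X} (hV : IsCoarseCover U V),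
      Sieve.ofArrows V (fun i => homOfLE (hV.subset i)) ∈ coarseTopology X U := fun {n U V} hV =>
    ⟨n, V, hV, fun i _ => Sieve.ofArrows_mk _ _ i⟩
  refine ⟨fun n U V hV s hs => ?_, fun n U V hV s hs => ?_⟩
  · have := (hP _ (hmem hV)).isSeparatedFor
    rw [Sieve.ofArrows, ← Presieve.isSeparatedFor_iff_generate] at this
    exact this.ext (t₁ := s) (t₂ := (0 : P.obj (op U))) (by
      rintro _ _ ⟨i⟩
      exact (hs i).trans (map_zero (res P (hV.subset i))).symm)
  · have := hP _ (hmem hV)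
    rw [Sieve.ofArrows, ← Presieve.isSheafFor_iff_generate, Presieve.isSheafFor_arrows_iff] at this
    obtain ⟨t, ht, -⟩ := this s (by
      intro i j Z gi gj _
      have hZ : Z ⊆ V i ∩ V j := Set.subset_inter (leOfHom gi) (leOfHom gj)
      have := congrArg (res P hZ) (hs i j)
      rw [res_res, res_res] at this
      exact this)
    exact ⟨t, ht⟩

/-- The empty family covers a bounded set, so vanishing on its members is no condition. -/
theorem HasCoarseGluing.eq_zero_of_isBounded {P : (Set X)ᵒᵖ ⥤ AddCommGrpCat.{u}}
    (hP : HasCoarseGluing P) {U : Set X} (hU : Bornology.IsBounded U) (s : P.obj (op U)) :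
    s = 0 :=
  hP.eq_zero (isCoarseCover_zero hU Fin.elim0) s fun i => i.elim0

theorem HasCoarseGluing.eq_of_pair {P : (Set X)ᵒᵖ ⥤ AddCommGrpCat.{u}}
    (hP : HasCoarseGluing P) {U V₁ V₂ : Set X} (hV : IsCoarseCover U ![V₁, V₂])
    (s t : P.obj (op U)) (h₁ : res P hV.left_subset s = res P hV.left_subset t)
    (h₂ : res P hV.right_subset s = res P hV.right_subset t) : s = t := by
  rw [← sub_eq_zero]
  refine hP.eq_zero hV _ fun i => ?_
  rw [map_sub, sub_eq_zero]
  fin_cases i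
  · exact h₁
  · exact h₂

theorem HasCoarseGluing.glue_pair {P : (Set X)ᵒᵖ ⥤ AddCommGrpCat.{u}}
    (hP : HasCoarseGluing P) {U V₁ V₂ : Set X} (hV : IsCoarseCover U ![V₁, V₂])
    (s₁ : P.obj (op V₁)) (s₂ : P.obj (op V₂))
    (h : res P (Set.inter_subset_left : V₁ ∩ V₂ ⊆ V₁) s₁ =
      res P (Set.inter_subset_right : V₁ ∩ V₂ ⊆ V₂) s₂) :
    ∃ t : P.obj (op U), res P hV.left_subset t = s₁ ∧ res P hV.right_subset t = s₂ := by
  have h' : res P (Set.inter_subset_left : V₂ ∩ V₁ ⊆ V₂) s₂ =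
      res P (Set.inter_subset_right : V₂ ∩ V₁ ⊆ V₁) s₁ := by
    have := congrArg (res P (Set.inter_comm V₂ V₁).subset) h
    rw [res_res, res_res] at this
    exact this.symm
  obtain ⟨t, ht⟩ := hP.glue hV (Fin.cons s₁ (Fin.cons s₂ fun i => i.elim0)) (by
    intro i j
    fin_cases i <;> fin_cases j
    · rfl
    · exact h
    · exact h'
    · rfl)
  exact ⟨t, ht 0, ht 1⟩

/-- Local exactness of a sequence of presheaves at the middle term. -/
def IsLocallyExact {P Q R : (Set X)ᵒᵖ ⥤ AddCommGrpCat.{u}} (f : P ⟶ Q) (g : Q ⟶ R) : Prop :=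
  ∀ (U : Set X) (s : Q.obj (op U)), onSections g U s = 0 →
    ∃ S ∈ coarseTopology X U, ∀ (V : Set X) (i : V ⟶ U), S i →
      ∃ t : P.obj (op V), onSections f V t = res Q (leOfHom i) s

/-- The sections of a locally exact complex of flabby sheaves form an exact complex. -/
theorem exact_sections_of_flabby (K : ℕ → (Set X)ᵒᵖ ⥤ AddCommGrpCat.{u})
    (d : ∀ n, K n ⟶ K (n + 1)) (hd : ∀ n, d n ≫ d (n + 1) = 0)
    (hK : ∀ n, HasCoarseGluing (K n)) (hfl : ∀ n, IsFlabby (K n))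
    (hinj : ∀ U s, onSections (d 0) U s = 0 → s = 0)
    (hex : ∀ n, IsLocallyExact (d n) (d (n + 1))) (n : ℕ) (U : Set X)
    (s : (K (n + 1)).obj (op U)) (hs : onSections (d (n + 1)) U s = 0) :
    ∃ t, onSections (d n) U t = s := by
  have hdd : ∀ n U s, onSections (d (n + 1)) U (onSections (d n) U s) = 0 := fun n U s =>
    congrArg (fun f => (f.app (op U)).hom s) (hd n)
  -- If cocycles in degree `n` extend to larger sets, local primitives in degree `n` can be glued,
  -- which gives exactness in degree `n + 1`. Conversely, `ext` gets the extension property from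
  -- exactness and flabbiness one degree lower, so the two statements climb together.
  have step : ∀ n, (∀ ⦃U V : Set X⦄ (h : U ⊆ V) (s : (K n).obj (op U)),
      onSections (d n) U s = 0 → ∃ t, onSections (d n) V t = 0 ∧ res (K n) h t = s) →
      ∀ U (s : (K (n + 1)).obj (op U)), onSections (d (n + 1)) U s = 0 →
        ∃ t, onSections (d n) U t = s := by
    intro n ih U s hs
    obtain ⟨S, hS, hloc⟩ := hex n U s hs
    suffices ∃ (h : U ⊆ U) (t : (K n).obj (op U)), onSections (d n) U t = res (K (n + 1)) h s by
      obtain ⟨_, t, ht⟩ := this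
      exact ⟨t, by simpa using ht⟩
    refine coarse_induction (fun W => ∃ (h : W ⊆ U) (t : (K n).obj (op W)),
      onSections (d n) W t = res (K (n + 1)) h s) ?_ ?_ ?_ hS fun V f hf => ⟨leOfHom f, hloc V f hf⟩
    · rintro V W hVW ⟨h, t, ht⟩
      exact ⟨hVW.trans h, res _ hVW t, by rw [onSections_res, ht, res_res]⟩
    · intro V hV hb
      exact ⟨hV, 0, ((hK (n + 1)).eq_zero_of_isBounded hb _).trans
        ((hK (n + 1)).eq_zero_of_isBounded hb _).symm⟩
    · rintro W hW V₁ V₂ hV ⟨h₁, t₁, ht₁⟩ ⟨h₂, t₂, ht₂⟩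
      have l : V₁ ∩ V₂ ⊆ V₁ := Set.inter_subset_left
      have r : V₁ ∩ V₂ ⊆ V₂ := Set.inter_subset_right
      -- The two primitives differ on the overlap by a cocycle. Its extension `z` to `V₁` corrects
      -- `t₁` without changing the coboundary.
      obtain ⟨z, hz, hz'⟩ := ih l (res (K n) r t₂ - res (K n) l t₁) (by
        rw [map_sub, onSections_res, onSections_res, ht₁, ht₂, res_res, res_res, sub_self])
      obtain ⟨t, e₁, e₂⟩ := (hK n).glue_pair hV (t₁ + z) t₂ (by rw [map_add, hz']; abel)
      refine ⟨hW, t, (hK (n + 1)).eq_of_pair hV _ _ ?_ ?_⟩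
      · rw [← onSections_res, e₁, map_add, hz, add_zero, ht₁, res_res]
      · rw [← onSections_res, e₂, ht₂, res_res]
  have ext : ∀ n, ∀ ⦃U V : Set X⦄ (h : U ⊆ V) (s : (K n).obj (op U)),
      onSections (d n) U s = 0 → ∃ t, onSections (d n) V t = 0 ∧ res (K n) h t = s := by
    intro n
    induction n with
    | zero =>
      intro U V h s hs
      exact ⟨0, map_zero _, by rw [hinj U s hs, map_zero]⟩
    | succ n ih =>
      intro U V h s hs
      -- The cocycle has a primitive by exactness, and the coboundary of an extended primitive
      -- extends the cocycle.
      obtain ⟨t, rfl⟩ := step n ih U s hs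
      obtain ⟨t, rfl⟩ := hfl n h t
      exact ⟨onSections (d n) V t, hdd n V t, (onSections_res _ _ _).symm⟩
  exact step n (ext n) U s hs

end Presheaves

/-! ### Blocky functions: supports, local vanishing, cones and gluing -/

section BlockyFunctions

variable {Y : Type u} {A : Type u} [AddCommGroup A]

theorem isBlocky_of_finite {q : ℕ} {φ : (Fin (q + 1) → Y) → A} {T : Type*} [Finite T] (b : Y → T)
    (h : ∀ x y : Fin (q + 1) → Y, (∀ i, b (x i) = b (y i)) → φ x = φ y) [MetricSpace Y] :
    IsBlocky φ :=
  ⟨Nat.card T, fun y => Finite.equivFin T (b y), fun x y hxy => h x y fun i => by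
    simpa using hxy i⟩

open Classical in
/-- Extension by zero of a function on the tuples in `U` to the tuples in `V`. -/
noncomputable def extendByZero {X : Type u} {U : Set X} (V : Set X) {q : ℕ}
    (φ : (Fin (q + 1) → U) → A) (x : Fin (q + 1) → V) : A :=
  if h : ∀ j, (x j : X) ∈ U then φ fun j => ⟨x j, h j⟩ else 0

theorem extendByZero_of_mem {X : Type u} {U V : Set X} {q : ℕ}
    (φ : (Fin (q + 1) → U) → A) (x : Fin (q + 1) → V) (h : ∀ j, (x j : X) ∈ U) :
    extendByZero V φ x = φ fun j => ⟨x j, h j⟩ :=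
  dif_pos h

theorem IsBlocky.extendByZero {X : Type u} [MetricSpace X] {U : Set X} (V : Set X) {q : ℕ}
    {φ : (Fin (q + 1) → U) → A} (hφ : IsBlocky φ) : IsBlocky (extendByZero V φ) := by
  classical
  obtain ⟨n, b, hb⟩ := hφ
  -- The additional block `none` collects the points outside `U`.
  refine isBlocky_of_finite (T := Option (Fin n))
    (fun x => if h : (x : X) ∈ U then some (b ⟨x, h⟩) else none) fun x y hxy => ?_
  have hmem : ∀ j, (x j : X) ∈ U ↔ (y j : X) ∈ U := fun j => by
    have := hxy j
    by_cases hx : (x j : X) ∈ U <;> by_cases hy : (y j : X) ∈ U <;> simp_all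
  by_cases hx : ∀ j, (x j : X) ∈ U
  · have hy : ∀ j, (y j : X) ∈ U := fun j => (hmem j).1 (hx j)
    rw [extendByZero_of_mem φ x hx, extendByZero_of_mem φ y hy]
    refine hb _ _ fun j => ?_
    simpa [hx j, hy j] using hxy j
  · have hy : ¬ ∀ j, (y j : X) ∈ U := fun h => hx fun j => (hmem j).2 (h j)
    simp only [CoarseMV.extendByZero, dif_neg hx, dif_neg hy]

theorem IsBlocky.comp {Z : Type u} [MetricSpace Y] [MetricSpace Z] {q : ℕ}
    {φ : (Fin (q + 1) → Y) → A} (hφ : IsBlocky φ) (f : Z → Y) :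
    IsBlocky (fun x : Fin (q + 1) → Z => φ fun j => f (x j)) :=
  pullbackFun_mem_blocky f q φ hφ

theorem IsBlocky.coboundaryFun [MetricSpace Y] {q : ℕ} {φ : (Fin (q + 1) → Y) → A}
    (hφ : IsBlocky φ) : IsBlocky (coboundaryFun q φ) :=
  coboundaryFun_mem_blocky q φ hφ

theorem IsCocontrolled.image {Y Z : Type u} [MetricSpace Y] [MetricSpace Z] {f : Z → Y}
    (hf : Isometry f) {q : ℕ} {C : Set (Fin (q + 1) → Z)} (hC : IsCocontrolled C) :
    IsCocontrolled ((fun x j => f (x j)) '' C) := fun R i => by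
  refine (hf.lipschitz.isBounded_image (hC R i)).subset ?_
  rintro _ ⟨_, ⟨⟨x, hx, rfl⟩, hR⟩, rfl⟩
  exact ⟨x i, ⟨x, ⟨hx, fun j k => by simpa [hf.dist_eq] using hR j k⟩, rfl⟩, rfl⟩

theorem IsCocontrolled.iUnion [MetricSpace Y] {ι : Type*} [Finite ι] {q : ℕ}
    {C : ι → Set (Fin (q + 1) → Y)} (hC : ∀ i, IsCocontrolled (C i)) :
    IsCocontrolled (⋃ i, C i) := fun R j => by
  refine (Bornology.isBounded_iUnion.2 fun i => hC i R j).subset ?_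
  rintro _ ⟨x, ⟨hx, hR⟩, rfl⟩
  obtain ⟨i, hi⟩ := Set.mem_iUnion.1 hx
  exact Set.mem_iUnion.2 ⟨i, x, ⟨hi, hR⟩, rfl⟩

theorem isometry_subtype_val {X : Type u} [MetricSpace X] (U : Set X) :
    Isometry (Subtype.val : U → X) := isometry_subtype_coe

/-- A set of tuples in `U` is cocontrolled if it is so on the members of a coarse cover. -/
theorem IsCocontrolled.of_cover {X : Type u} [MetricSpace X] {n : ℕ} {U : Set X}
    {V : Fin n → Set X} (hV : IsCoarseCover U V) {q : ℕ} {C : Set (Fin (q + 1) → U)}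
    (hC : ∀ i, IsCocontrolled
      ((fun (x : Fin (q + 1) → V i) j => Set.inclusion (hV.subset i) (x j)) ⁻¹' C)) :
    IsCocontrolled C := by
  rw [isCoarseCover_iff] at hV
  intro R k
  have hb : Bornology.IsBounded ((Subtype.val : U → X) ⁻¹'
      {x | x ∈ U ∧ ∀ i, ∃ y ∈ U, y ∉ V i ∧ dist x y ≤ max R 0}) :=
    (isometry_subtype_val U).antilipschitz.isBounded_preimage (hV.2 _ (le_max_right _ _))
  refine (hb.union (Bornology.isBounded_iUnion.2 fun i => (isometry_inclusion
    (hV.1 i)).lipschitz.isBounded_image (hC i R k))).subset ?_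
  rintro _ ⟨x, ⟨hx, hR⟩, rfl⟩
  -- Either the simplex lies in one member, or for every `i` it has a vertex outside `V i`; then
  -- each vertex is within `R` of every complement.
  by_cases hc : ∃ i, ∀ j, (x j : X) ∈ V i
  · obtain ⟨i, hi⟩ := hc
    refine Or.inr (Set.mem_iUnion.2 ⟨i, ⟨x k, hi k⟩, ⟨fun j => ⟨x j, hi j⟩, ⟨hx, fun j l => ?_⟩,
      rfl⟩, rfl⟩)
    exact hR j l
  · push Not at hc
    refine Or.inl ⟨(x k).2, fun i => ?_⟩
    obtain ⟨j, hj⟩ := hc i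
    exact ⟨x j, (x j).2, hj, (hR k j).trans (le_max_left _ _)⟩

theorem mem_coarseTopology_of_finite {X : Type u} [MetricSpace X] {ι : Type} [Finite ι]
    {U : Set X} {V : ι → Set X} (hV : IsCoarseCover U V) {S : Sieve U}
    (hS : ∀ i (h : V i ⊆ U), S (homOfLE h)) : S ∈ coarseTopology X U := by
  let e := Finite.equivFin ι
  refine ⟨Nat.card ι, fun k => V (e.symm k), ?_, fun k h => hS (e.symm k) h⟩
  rw [isCoarseCover_iff] at hV ⊢
  refine ⟨fun k => hV.1 _, fun R hR => (hV.2 R hR).subset ?_⟩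
  rintro x ⟨hx, h⟩
  exact ⟨hx, fun i => by simpa using h (e i)⟩

/-- A blocky function with cocontrolled support vanishes locally. -/
theorem exists_cover_eq_zero {X : Type u} [MetricSpace X] {U : Set X} {q : ℕ}
    {ψ : (Fin (q + 1) → U) → A} (hψ : IsBlocky ψ) (hc : IsCocontrolled {x | ψ x ≠ 0}) :
    ∃ S ∈ coarseTopology X U, ∀ (V : Set X) (i : V ⟶ U), S i →
      ∀ x : Fin (q + 1) → V, ψ (fun j => Set.inclusion (leOfHom i) (x j)) = 0 := by
  let S : Sieve U :=
    { arrows := fun V i => ∀ x : Fin (q + 1) → V,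
        ψ (fun j => Set.inclusion (leOfHom i) (x j)) = 0
      downward_closed := fun {V W i} hi j x => hi fun k => Set.inclusion (leOfHom j) (x k) }
  refine ⟨S, ?_, fun V i hi => hi⟩
  obtain ⟨n, b, hb⟩ := hψ
  -- `N σ R` is the set of points within `R` of all the blocks in `σ`. The set `V σ` is the union of
  -- these blocks if `N σ R` is unbounded for some `R`, and empty otherwise.
  let N : Set (Fin n) → ℝ → Set X := fun σ R =>
    {x | x ∈ U ∧ ∀ i ∈ σ, ∃ y : U, b y = i ∧ dist x y ≤ R}
  let V : Set (Fin n) → Set X := fun σ =>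
    {x | (∃ R, ¬ Bornology.IsBounded (N σ R)) ∧ ∃ h : x ∈ U, b ⟨x, h⟩ ∈ σ}
  have hV : IsCoarseCover U V := by
    refine (isCoarseCover_iff _ _).2 ⟨fun σ x hx => hx.2.1, fun R hR => ?_⟩
    have hbd : Bornology.IsBounded (⋃ σ : {σ : Set (Fin n) // Bornology.IsBounded (N σ R)},
      N σ.1 R) := Bornology.isBounded_iUnion.2 fun σ => σ.2
    refine hbd.subset ?_
    rintro x ⟨hxU, hx⟩
    -- The blocks met by the `R`-ball around `x` in `U`. If `N σ R` were unbounded, this ball would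
    -- lie in `V σ`; hence `x` is in one of finitely many bounded sets.
    let σ : Set (Fin n) := {i | ∃ y : U, b y = i ∧ dist x y ≤ R}
    have hxσ : x ∈ N σ R := ⟨hxU, fun i hi => hi⟩
    refine Set.mem_iUnion.2 ⟨⟨σ, ?_⟩, hxσ⟩
    by_contra hunb
    obtain ⟨y, hyU, hy, hd⟩ := hx σ
    exact hy ⟨⟨R, hunb⟩, hyU, ⟨y, hyU⟩, rfl, hd⟩
  refine mem_coarseTopology_of_finite hV fun σ h x => ?_
  by_contra hx
  obtain ⟨R, hR⟩ := (x 0).2.1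
  refine hR ?_
  have hbd := (isometry_subtype_val U).lipschitz.isBounded_image (hc (2 * R) 0)
  refine (hbd.cthickening (δ := R)).subset ?_
  rintro z ⟨hzU, hz⟩
  -- Blockiness moves the nonzero value from `x` to a tuple `y` in the same blocks near `z`. It has
  -- diameter at most `2 * R`, so cocontrolled support would make `N σ R` bounded.
  choose y hy hd using fun j => hz _ (x j).2.2.2
  refine Metric.mem_cthickening_of_dist_le z (y 0) _ _ ⟨y 0, ⟨y, ⟨?_, fun j k => ?_⟩, rfl⟩, rfl⟩
    (hd 0)
  · have := hb y _ hy
    rw [← this] at hx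
    exact hx
  · have := dist_triangle_left (y j : X) (y k) z
    have h1 := hd j
    have h2 := hd k
    rw [Subtype.dist_eq]
    linarith

/-- A cocycle in positive degree on a non-empty set is a coboundary. -/
theorem coboundaryFun_cone {q : ℕ} (φ : (Fin (q + 2) → Y) → A) [MetricSpace Y]
    (hφ : coboundaryFun (q + 1) φ = 0) (p : Y) :
    coboundaryFun q (fun x => φ (Fin.cons p x)) = φ := by
  ext x
  -- The face omitting `p` contributes `φ x`; the other faces contribute the coboundary of the cone
  -- with the opposite sign.
  have h := congrFun hφ (Fin.cons p x)
  rw [coboundaryFun_apply, Fin.sum_univ_succ] at h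
  rw [coboundaryFun_apply]
  have hs : ∀ i : Fin (q + 2), (fun j => (Fin.cons p x : Fin (q + 3) → Y) (i.succ.succAbove j)) =
      Fin.cons p (fun j => x (i.succAbove j)) := fun i => by
    funext j
    refine Fin.cases ?_ (fun j => ?_) j <;> simp
  simp only [hs, Fin.val_zero, pow_zero, one_smul, Fin.zero_succAbove, Fin.cons_succ,
    Fin.val_succ, pow_succ, mul_neg, mul_one, neg_smul, Finset.sum_neg_distrib, Pi.zero_apply] at h
  exact (sub_eq_zero.1 ((sub_eq_add_neg _ _).trans h)).symm

theorem IsBlocky.cone [MetricSpace Y] {q : ℕ} {φ : (Fin (q + 2) → Y) → A} (hφ : IsBlocky φ)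
    (p : Y) : IsBlocky (fun x => φ (Fin.cons p x)) := by
  obtain ⟨n, b, hb⟩ := hφ
  refine ⟨n, b, fun x y h => hb _ _ fun i => ?_⟩
  refine Fin.cases rfl (fun j => ?_) i
  simpa using h j

/-- Cochains on the members of a coarse cover which agree up to cocontrolled sets on the
intersections come from a cochain. -/
theorem exists_glue_blocky {X : Type u} [MetricSpace X] {n : ℕ} {U : Set X}
    {V : Fin n → Set X} (hV : IsCoarseCover U V) {q : ℕ}
    (φ : ∀ i, (Fin (q + 1) → V i) → A) (hφ : ∀ i, IsBlocky (φ i))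
    (h : ∀ i j, IsCocontrolled {x : Fin (q + 1) → ↥(V i ∩ V j) |
      φ i (fun k => Set.inclusion Set.inter_subset_left (x k)) ≠
        φ j (fun k => Set.inclusion Set.inter_subset_right (x k))}) :
    ∃ ψ : (Fin (q + 1) → U) → A, IsBlocky ψ ∧ ∀ i, IsCocontrolled {x : Fin (q + 1) → V i |
      ψ (fun k => Set.inclusion (hV.subset i) (x k)) ≠ φ i x} := by
  classical
  -- The chosen index depends on a tuple only through the set of members containing it, which keeps
  -- the glued function blocky in spite of the choice.
  let g : (Fin n → Prop) → (Fin (q + 1) → U) → A := fun p x =>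
    if hp : ∃ i, p i then extendByZero U (φ hp.choose) x else 0
  let p : (Fin (q + 1) → U) → Fin n → Prop := fun x i => ∀ j, (x j : X) ∈ V i
  refine ⟨fun x => g (p x) x, ?_, fun i => ?_⟩
  · choose m b hb using fun i => (hφ i).extendByZero U
    refine isBlocky_of_finite (T := (∀ i, Fin (m i)) × (Fin n → Prop))
      (fun x => (fun i => b i x, fun i => (x : X) ∈ V i)) fun x y hxy => ?_
    simp only [Prod.mk.injEq] at hxy
    have hp : p x = p y := by
      funext i
      exact forall_congr fun j => congrFun (hxy j).2 i
    simp only [hp, g]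
    split
    · exact hb _ _ _ fun j => congrFun (hxy j).1 _
    · rfl
  -- On a tuple in `V i` the glued function equals some `φ k`, so it differs from `φ i` only where
  -- these two disagree on `V k ∩ V i`.
  · refine (IsCocontrolled.iUnion fun k => (h k i).image
      (isometry_inclusion (Set.inter_subset_right : V k ∩ V i ⊆ V i))).mono fun x hx => ?_
    set x' : Fin (q + 1) → U := fun k => Set.inclusion (hV.subset i) (x k) with hx'
    have hp : ∃ k, p x' k := ⟨i, fun j => (x j).2⟩
    have hk : p x' hp.choose := hp.choose_spec
    refine Set.mem_iUnion.2 ⟨hp.choose, fun j => ⟨x j, hk j, (x j).2⟩, ?_, rfl⟩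
    have hx2 : g (p x') x' ≠ φ i x := hx
    simp only [g, dif_pos hp] at hx2
    rw [extendByZero_of_mem _ _ hk] at hx2
    exact hx2

end BlockyFunctions

/-! ### The sheaves of coarse cochains and their local exactness -/

section CochainSheaves

variable (X : Type u) [MetricSpace X] (A : Type u) [AddCommGroup A]

/-- The presheaf `U ↦ CY_b^q(U; A)`. -/
abbrev cochainPresheaf (q : ℕ) : (Set X)ᵒᵖ ⥤ AddCommGrpCat.{u} :=
  coarseCochainPresheaf X A ⋙ HomologicalComplex.eval _ _ q

variable {X A}

/-- The section of `CY_b^q(-; A)` given by a blocky function. -/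
def cochainClass {q : ℕ} {U : Set X} (φ : (Fin (q + 1) → U) → A) (hφ : IsBlocky φ) :
    (cochainPresheaf X A q).obj (op U) :=
  (QuotientAddGroup.mk (⟨φ, hφ⟩ : blockyCochains U A q) : CoarseCochains U A q)

theorem exists_cochainClass {q : ℕ} {U : Set X} (s : (cochainPresheaf X A q).obj (op U)) :
    ∃ (φ : (Fin (q + 1) → U) → A) (hφ : IsBlocky φ), cochainClass φ hφ = s := by
  obtain ⟨⟨φ, hφ⟩, rfl⟩ := QuotientAddGroup.mk_surjective (s : CoarseCochains U A q)
  exact ⟨φ, hφ, rfl⟩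

theorem cochainClass_eq_zero_iff {q : ℕ} {U : Set X} {φ : (Fin (q + 1) → U) → A}
    {hφ : IsBlocky φ} : cochainClass φ hφ = 0 ↔ IsCocontrolled {x | φ x ≠ 0} := by
  refine (QuotientAddGroup.eq_zero_iff (⟨φ, hφ⟩ : blockyCochains U A q)).trans ?_
  exact ⟨fun h => h.2, fun h => ⟨hφ, h⟩⟩

theorem cochainClass_sub {q : ℕ} {U : Set X} {φ ψ : (Fin (q + 1) → U) → A}
    (hφ : IsBlocky φ) (hψ : IsBlocky ψ) : cochainClass φ hφ - cochainClass ψ hψ =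
      cochainClass (fun x => φ x - ψ x) (hφ.map₂ hψ fun a b => a - b) := rfl

theorem cochainClass_eq_iff {q : ℕ} {U : Set X} {φ ψ : (Fin (q + 1) → U) → A}
    {hφ : IsBlocky φ} {hψ : IsBlocky ψ} :
    cochainClass φ hφ = cochainClass ψ hψ ↔ IsCocontrolled {x | φ x ≠ ψ x} := by
  rw [← sub_eq_zero, cochainClass_sub, cochainClass_eq_zero_iff]
  simp only [ne_eq, sub_eq_zero]

theorem res_cochainClass {q : ℕ} {U V : Set X} (h : U ⊆ V) (φ : (Fin (q + 1) → V) → A)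
    (hφ : IsBlocky φ) : res (cochainPresheaf X A q) h (cochainClass φ hφ) =
      cochainClass (fun x => φ fun j => Set.inclusion h (x j)) (hφ.comp _) :=
  rfl

variable (X A) in
/-- The coboundary as a morphism of presheaves. -/
def cochainPresheafD (q r : ℕ) : cochainPresheaf X A q ⟶ cochainPresheaf X A r where
  app U := ((coarseCochainPresheaf X A).obj U).d q r
  naturality _ _ f := ((coarseCochainPresheaf X A).map f).comm q r

theorem cochainPresheafD_cochainClass {q : ℕ} {U : Set X} (φ : (Fin (q + 1) → U) → A)
    (hφ : IsBlocky φ) : onSections (cochainPresheafD X A q (q + 1)) U (cochainClass φ hφ) =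
      cochainClass (coboundaryFun q φ) hφ.coboundaryFun := by
  have : ((coarseCochainPresheaf X A).obj (op U)).d q (q + 1) = AddCommGrpCat.ofHom
      (coarseCochainsMap (coboundaryFun q) (coboundaryFun_mem_blocky q)
        (coboundaryFun_mem_cocontrolled q)) := by
    change (coarseCochainComplex U A).d q (q + 1) = _
    simp only [coarseCochainComplex, CochainComplex.of_d]
  exact congrArg (fun f => f.hom (cochainClass φ hφ)) this

theorem isFlabby_cochainPresheaf (q : ℕ) : IsFlabby (cochainPresheaf X A q) := by
  intro U V h s
  obtain ⟨φ, hφ, rfl⟩ := exists_cochainClass s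
  refine ⟨cochainClass _ (hφ.extendByZero V), ?_⟩
  rw [res_cochainClass]
  congr 1
  funext x
  exact extendByZero_of_mem φ _ fun j => (x j).2

theorem hasCoarseGluing_cochainPresheaf (q : ℕ) : HasCoarseGluing (cochainPresheaf X A q) where
  eq_zero n U V hV s hs := by
    obtain ⟨φ, hφ, rfl⟩ := exists_cochainClass s
    rw [cochainClass_eq_zero_iff]
    refine IsCocontrolled.of_cover hV fun i => ?_
    have := hs i
    rwa [res_cochainClass, cochainClass_eq_zero_iff] at this
  glue n U V hV s hs := by
    choose φ hφ hs' using fun i => exists_cochainClass (s i)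
    obtain ⟨ψ, hψ, h⟩ := exists_glue_blocky hV φ hφ fun i j => by
      have := hs i j
      rwa [← hs', ← hs', res_cochainClass, res_cochainClass, cochainClass_eq_iff] at this
    refine ⟨cochainClass ψ hψ, fun i => ?_⟩
    rw [← hs', res_cochainClass, cochainClass_eq_iff]
    exact h i

/-- A class which is a cocycle is locally the class of a cocycle of functions. -/
theorem exists_cover_coboundaryFun_eq_zero {q : ℕ} {U : Set X} {φ : (Fin (q + 1) → U) → A}
    {hφ : IsBlocky φ}
    (h : onSections (cochainPresheafD X A q (q + 1)) U (cochainClass φ hφ) = 0) :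
    ∃ S ∈ coarseTopology X U, ∀ (V : Set X) (i : V ⟶ U), S i →
      coboundaryFun q (fun x : Fin (q + 1) → V =>
        φ fun j => Set.inclusion (leOfHom i) (x j)) = 0 := by
  rw [cochainPresheafD_cochainClass, cochainClass_eq_zero_iff] at h
  obtain ⟨S, hS, h'⟩ := exists_cover_eq_zero hφ.coboundaryFun h
  exact ⟨S, hS, fun V i hi => funext fun x => h' V i hi x⟩

/-- Where the cocycle is a cocycle of functions, the cone from any point is a primitive; over an
empty member every class is zero. -/
theorem isLocallyExact_cochainPresheafD (q : ℕ) :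
    IsLocallyExact (cochainPresheafD X A q (q + 1)) (cochainPresheafD X A (q + 1) (q + 2)) := by
  intro U s hs
  obtain ⟨φ, hφ, rfl⟩ := exists_cochainClass s
  obtain ⟨S, hS, h⟩ := exists_cover_coboundaryFun_eq_zero hs
  refine ⟨S, hS, fun V i hi => ?_⟩
  have hφ' : IsBlocky (fun x : Fin (q + 2) → V => φ fun j => Set.inclusion (leOfHom i) (x j)) :=
    hφ.comp _
  rcases isEmpty_or_nonempty V with hV | ⟨⟨p⟩⟩
  · refine ⟨0, ?_⟩
    rw [map_zero, res_cochainClass, eq_comm, cochainClass_eq_zero_iff]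
    intro R k
    refine Bornology.isBounded_empty.subset ?_
    rintro x -
    exact hV.elim x
  · refine ⟨cochainClass _ (hφ'.cone p), ?_⟩
    rw [cochainPresheafD_cochainClass, res_cochainClass]
    congr 1
    exact coboundaryFun_cone _ (h V i hi) p

/-- Degree zero cocycles are locally constant. -/
theorem exists_cover_const {U : Set X} (s : (cochainPresheaf X A 0).obj (op U))
    (hs : onSections (cochainPresheafD X A 0 1) U s = 0) :
    ∃ S ∈ coarseTopology X U, ∀ (V : Set X) (i : V ⟶ U), S i →
      ∃ a : A, cochainClass (fun _ => a) (isBlocky_const a) =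
        res (cochainPresheaf X A 0) (leOfHom i) s := by
  obtain ⟨φ, hφ, rfl⟩ := exists_cochainClass s
  obtain ⟨S, hS, h⟩ := exists_cover_coboundaryFun_eq_zero hs
  refine ⟨S, hS, fun V i hi => ?_⟩
  rcases isEmpty_or_nonempty V with hV | ⟨⟨p⟩⟩
  · refine ⟨0, ?_⟩
    rw [res_cochainClass]
    congr 1
    funext x
    exact hV.elim (x 0)
  · refine ⟨φ fun _ => Set.inclusion (leOfHom i) p, ?_⟩
    rw [res_cochainClass]
    congr 1
    funext x
    -- At the pair `(x 0, p)` the cocycle condition says that the values at `p` and at `x 0` agree.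
    have := congrFun (h V i hi) ![x 0, p]
    change (∑ k : Fin 2, (-1 : ℤ) ^ (k : ℕ) •
      φ (fun j => Set.inclusion (leOfHom i) (![x 0, p] (k.succAbove j)))) = 0 at this
    simp only [Fin.sum_univ_two, Fin.val_zero, pow_zero, one_smul,
      Fin.val_one, pow_one, neg_smul, ← sub_eq_add_neg, sub_eq_zero] at this
    convert this using 2
    · funext j
      obtain rfl : j = 0 := Fin.fin_one_eq_zero j
      rfl
    · funext j
      obtain rfl : j = 0 := Fin.fin_one_eq_zero j
      rfl

/-- A nonzero constant is supported everywhere and simplices with one vertex have diameter zero.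
Constants are thus detected over every unbounded set, which makes the augmentation injective. -/
theorem isBounded_of_cochainClass_const_eq_zero {U : Set X} {a : A} (ha : a ≠ 0)
    (h : cochainClass (q := 0) (U := U) (fun _ => a) (isBlocky_const a) = 0) :
    Bornology.IsBounded U := by
  rw [cochainClass_eq_zero_iff] at h
  refine ((isometry_subtype_val U).lipschitz.isBounded_image (h 0 0)).subset fun x hx => ?_
  refine ⟨⟨x, hx⟩, ⟨fun _ => ⟨x, hx⟩, ⟨ha, fun _ _ => by simp⟩, rfl⟩, rfl⟩

end CochainSheaves

/-! ### Cohomology of complexes of abelian groups in terms of elements -/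

section AbelianComplexes

variable {K L : CochainComplex AddCommGrpCat.{u} ℕ}

theorem exists_iCycles_eq {n k : ℕ} (hk : (ComplexShape.up ℕ).next n = k) (x : K.X n)
    (hx : (K.d n k).hom x = 0) : ∃ z : K.cycles n, (K.iCycles n).hom z = x := by
  subst hk
  exact ⟨(K.sc n).abCyclesIso.inv.hom ⟨x, hx⟩, (K.sc n).abCyclesIso_inv_apply_iCycles ⟨x, hx⟩⟩

theorem iCycles_injective (n : ℕ) : Function.Injective (K.iCycles n).hom :=
  (AddCommGrpCat.mono_iff_injective _).1 inferInstance

theorem homologyπ_surjective (n : ℕ) : Function.Surjective (K.homologyπ n).hom :=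
  (AddCommGrpCat.epi_iff_surjective _).1 inferInstance

theorem d_iCycles {n : ℕ} (k : ℕ) (z : K.cycles n) : (K.d n k).hom ((K.iCycles n).hom z) = 0 :=
  congrArg (fun f => f.hom z) (K.iCycles_d n k)

theorem iCycles_toCycles (i n : ℕ) (w : K.X i) :
    (K.iCycles n).hom ((K.toCycles i n).hom w) = (K.d i n).hom w :=
  congrArg (fun f => f.hom w) (K.toCycles_i i n)

theorem homologyπ_toCycles (i n : ℕ) (w : K.X i) :
    (K.homologyπ n).hom ((K.toCycles i n).hom w) = 0 :=
  congrArg (fun f => f.hom w) (K.toCycles_comp_homologyπ i n)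

theorem exists_toCycles_eq {i n : ℕ} (hi : (ComplexShape.up ℕ).prev n = i) (z : K.cycles n)
    (hz : (K.homologyπ n).hom z = 0) : ∃ w, (K.toCycles i n).hom w = z := by
  have h := ShortComplex.exact_of_g_is_cokernel (ShortComplex.mk _ _ (K.toCycles_comp_homologyπ i n))
    (K.homologyIsCokernel i n hi)
  exact (ShortComplex.ab_exact_iff _).1 h z hz

/-- An elementwise criterion for isomorphisms on cohomology. -/
theorem isIso_homologyMap_of_elements (g : K ⟶ L) {i n k : ℕ}
    (hi : (ComplexShape.up ℕ).prev n = i) (hk : (ComplexShape.up ℕ).next n = k)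
    (inj : ∀ (x : K.X n) (w : L.X i), (K.d n k).hom x = 0 → (g.f n).hom x = (L.d i n).hom w →
      ∃ v : K.X i, (K.d i n).hom v = x)
    (surj : ∀ y : L.X n, (L.d n k).hom y = 0 → ∃ (x : K.X n) (w : L.X i),
      (K.d n k).hom x = 0 ∧ (g.f n).hom x + (L.d i n).hom w = y) :
    IsIso (HomologicalComplex.homologyMap g n) := by
  have hπ : ∀ z, (HomologicalComplex.homologyMap g n).hom ((K.homologyπ n).hom z) =
      (L.homologyπ n).hom ((HomologicalComplex.cyclesMap g n).hom z) := fun z =>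
    congrArg (fun f => f.hom z) (HomologicalComplex.homologyπ_naturality g n)
  have hc : ∀ z, (L.iCycles n).hom ((HomologicalComplex.cyclesMap g n).hom z) =
      (g.f n).hom ((K.iCycles n).hom z) := fun z =>
    congrArg (fun f => f.hom z) (HomologicalComplex.cyclesMap_i g n)
  have : Mono (HomologicalComplex.homologyMap g n) := by
    rw [AddCommGrpCat.mono_iff_injective, injective_iff_map_eq_zero]
    intro a ha
    obtain ⟨z, rfl⟩ := homologyπ_surjective n a
    obtain ⟨w, hw⟩ := exists_toCycles_eq hi _ ((hπ z).symm.trans ha)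
    obtain ⟨v, hv⟩ := inj _ w (d_iCycles k z) (by rw [← hc, ← hw, iCycles_toCycles])
    have hz : (K.toCycles i n).hom v = z := iCycles_injective n (by rw [iCycles_toCycles, hv])
    rw [← hz, homologyπ_toCycles]
  have : Epi (HomologicalComplex.homologyMap g n) := by
    rw [AddCommGrpCat.epi_iff_surjective]
    intro b
    obtain ⟨z', rfl⟩ := homologyπ_surjective n b
    obtain ⟨x, w, hx, h⟩ := surj _ (d_iCycles k z')
    obtain ⟨z, rfl⟩ := exists_iCycles_eq hk x hx
    refine ⟨(K.homologyπ n).hom z, (hπ z).trans ?_⟩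
    have hz : (HomologicalComplex.cyclesMap g n).hom z + (L.toCycles i n).hom w = z' :=
      iCycles_injective n (by rw [map_add, hc, iCycles_toCycles, h])
    rw [← hz, map_add, homologyπ_toCycles, add_zero]
  exact isIso_of_mono_of_epi _

end AbelianComplexes

/-! ### Exactness of abelian sheaves, and flabbiness of injective ones -/

section Sheaves

variable {X : Type u} [MetricSpace X]

/-- Abelian sheaves on the coarse site. -/
abbrev CoarseSheaf (X : Type u) [MetricSpace X] :=
  Sheaf (coarseTopology X) AddCommGrpCat.{u}

theorem CoarseSheaf.hasCoarseGluing (F : CoarseSheaf X) : HasCoarseGluing F.obj :=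
  hasCoarseGluing_of_isSheaf F.property

theorem onSections_injective {F G : CoarseSheaf X} (f : F ⟶ G) [Mono f] (U : Set X) :
    Function.Injective (onSections f.hom U) := by
  have : Mono ((sheafToPresheaf (coarseTopology X) AddCommGrpCat.{u}).map f) := inferInstance
  have : Mono (f.hom.app (op U)) :=
    inferInstanceAs (Mono (((sheafToPresheaf (coarseTopology X) AddCommGrpCat.{u}).map f).app _))
  exact (AddCommGrpCat.mono_iff_injective _).1 this

theorem onSections_comp_eq_zero {F G H : CoarseSheaf X} {f : F ⟶ G} {g : G ⟶ H} (h : f ≫ g = 0)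
    (U : Set X) (s : F.obj.obj (op U)) : onSections g.hom U (onSections f.hom U s) = 0 :=
  congrArg (fun k => (k.hom.app (op U)).hom s) h

/-- Taking sections over `U` is left exact. -/
theorem sections_exact_of_mono {S : ShortComplex (CoarseSheaf X)} (hS : S.Exact) (hf : Mono S.f)
    (U : Set X) (s : S.X₂.obj.obj (op U)) (h : onSections S.g.hom U s = 0) :
    ∃ t, onSections S.f.hom U t = s := by
  have h1 := hS.map_of_mono_of_preservesKernel (sheafToPresheaf (coarseTopology X) AddCommGrpCat.{u})
    hf inferInstance
  have h2 := h1.map ((evaluation (Set X)ᵒᵖ AddCommGrpCat.{u}).obj (op U))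
  exact (ShortComplex.ab_exact_iff _).1 h2 s h

/-- Exactness of sheaves is local exactness of sections. -/
theorem exact_iff_isLocallyExact (S : ShortComplex (CoarseSheaf X)) :
    S.Exact ↔ IsLocallyExact S.f.hom S.g.hom := by
  -- Exactness means that the map to the kernel of `S.g` is an epimorphism, that is, locally
  -- surjective. By left exactness, sections of the kernel are the sections killed by `S.g`.
  rw [ShortComplex.exact_iff_epi_kernel_lift, ← Sheaf.isLocallySurjective_iff_epi']
  have hker : ∀ U (s : S.X₂.obj.obj (op U)), onSections S.g.hom U s = 0 →
      ∃ t, onSections (Limits.kernel.ι S.g).hom U t = s := fun U s hs =>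
    sections_exact_of_mono (S := ShortComplex.mk _ _ (Limits.kernel.condition S.g))
      (ShortComplex.exact_kernel S.g) inferInstance U s hs
  have hι : ∀ U t, onSections (Limits.kernel.ι S.g).hom U
      (onSections (Limits.kernel.lift S.g S.f S.zero).hom U t) = onSections S.f.hom U t :=
    fun U t => congrArg (fun k => (k.hom.app (op U)).hom t) (Limits.kernel.lift_ι S.g S.f S.zero)
  constructor
  · intro h U s hs
    obtain ⟨r, rfl⟩ := hker U s hs
    refine ⟨_, h.imageSieve_mem r, ?_⟩
    rintro V i ⟨t, ht⟩
    refine ⟨t, ?_⟩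
    rw [← hι, ← onSections_res]
    exact congrArg (onSections (Limits.kernel.ι S.g).hom V) ht
  · refine fun h => ⟨fun {U} r => ?_⟩
    obtain ⟨T, hT, h'⟩ := h U (onSections (Limits.kernel.ι S.g).hom U r)
      (onSections_comp_eq_zero (Limits.kernel.condition S.g) U r)
    refine (coarseTopology X).superset_covering ?_ hT
    intro V i hi
    obtain ⟨t, ht⟩ := h' V i hi
    refine ⟨t, onSections_injective (Limits.kernel.ι S.g) V ?_⟩
    exact (hι V t).trans (ht.trans (onSections_res _ _ _).symm)

/-- Injective sheaves are flabby. -/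
theorem isFlabby_of_injective (I : CoarseSheaf X) [Injective I] : IsFlabby I.obj := by
  intro U V h s
  -- Sections over `U` are the morphisms from the free abelian sheaf on the presheaf represented by
  -- `U`. Free abelian groups and sheafification preserve monomorphisms, so `U ⊆ V` induces a
  -- monomorphism of such sheaves, along which morphisms to `I` extend.
  let adj := (AddCommGrpCat.adj.{u}.whiskerRight (Set X)ᵒᵖ).comp
    (sheafificationAdjunction (coarseTopology X) AddCommGrpCat.{u})
  let m := yoneda.map (homOfLE h)
  let L := (Functor.whiskeringRight (Set X)ᵒᵖ (Type u) AddCommGrpCat.{u}).obj AddCommGrpCat.free.{u} ⋙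
    presheafToSheaf (coarseTopology X) AddCommGrpCat.{u}
  have hm : Mono (((Functor.whiskeringRight (Set X)ᵒᵖ (Type u) AddCommGrpCat.{u}).obj AddCommGrpCat.free.{u}).map m) := by
    have : ∀ W, Mono ((((Functor.whiskeringRight (Set X)ᵒᵖ (Type u) AddCommGrpCat.{u}).obj
        AddCommGrpCat.free.{u}).map m).app W) := fun W =>
      inferInstanceAs (Mono (AddCommGrpCat.free.{u}.map (m.app W)))
    exact NatTrans.mono_of_mono_app _
  have : Mono (L.map m) := inferInstanceAs (Mono ((presheafToSheaf
    (coarseTopology X) AddCommGrpCat.{u}).map (((Functor.whiskeringRight (Set X)ᵒᵖ (Type u) AddCommGrpCat.{u}).obj AddCommGrpCat.free.{u}).map m)))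
  let σ : yoneda.obj U ⟶ I.obj ⋙ forget AddCommGrpCat.{u} := yonedaEquiv.symm s
  let g : L.obj (yoneda.obj U) ⟶ I := (adj.homEquiv _ _).symm σ
  let k := Injective.factorThru g (L.map m)
  have hk : L.map m ≫ k = g := Injective.comp_factorThru g (L.map m)
  refine ⟨yonedaEquiv ((adj.homEquiv _ _) k), ?_⟩
  have h1 : m ≫ (adj.homEquiv _ _) k = σ := by
    rw [← adj.homEquiv_naturality_left, hk]
    exact (adj.homEquiv _ _).apply_symm_apply σ
  have h2 := congrArg yonedaEquiv h1
  rw [Equiv.apply_symm_apply] at h2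
  rw [← h2]
  exact yonedaEquiv_naturality (adj.homEquiv (yoneda.obj V) I k) (homOfLE h)

end Sheaves

/-! ### The mapping fibre of a morphism of complexes of flabby sheaves -/

section MappingFibre

variable {X : Type u}

/-- The product of two presheaves of abelian groups. -/
def prodPresheaf (P Q : (Set X)ᵒᵖ ⥤ AddCommGrpCat.{u}) : (Set X)ᵒᵖ ⥤ AddCommGrpCat.{u} where
  obj U := AddCommGrpCat.of (P.obj U × Q.obj U)
  map f := AddCommGrpCat.ofHom ((P.map f).hom.prodMap (Q.map f).hom)
  map_id U := by
    ext x
    · exact congrArg (fun k => k.hom x.1) (P.map_id U)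
    · exact congrArg (fun k => k.hom x.2) (Q.map_id U)
  map_comp f g := by
    ext x
    · exact congrArg (fun k => k.hom x.1) (P.map_comp f g)
    · exact congrArg (fun k => k.hom x.2) (Q.map_comp f g)

theorem IsFlabby.prod {P Q : (Set X)ᵒᵖ ⥤ AddCommGrpCat.{u}} (hP : IsFlabby P)
    (hQ : IsFlabby Q) : IsFlabby (prodPresheaf P Q) := by
  intro U V h s
  obtain ⟨t, ht⟩ := hP h s.1
  obtain ⟨r, hr⟩ := hQ h s.2
  exact ⟨(t, r), Prod.ext ht hr⟩

variable [MetricSpace X]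

theorem HasCoarseGluing.prod {P Q : (Set X)ᵒᵖ ⥤ AddCommGrpCat.{u}} (hP : HasCoarseGluing P)
    (hQ : HasCoarseGluing Q) : HasCoarseGluing (prodPresheaf P Q) where
  eq_zero n U V hV s hs := Prod.ext (hP.eq_zero hV s.1 fun i => congrArg Prod.fst (hs i))
    (hQ.eq_zero hV s.2 fun i => congrArg Prod.snd (hs i))
  glue n U V hV s hs := by
    obtain ⟨t, ht⟩ := hP.glue hV (fun i => (s i).1) fun i j => congrArg Prod.fst (hs i j)
    obtain ⟨r, hr⟩ := hQ.glue hV (fun i => (s i).2) fun i j => congrArg Prod.snd (hs i j)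
    exact ⟨(t, r), fun i => Prod.ext (ht i) (hr i)⟩

/-- The presheaves `0, I⁰, I¹, …` of a complex of sheaves. -/
noncomputable def shiftedPresheaf (I : CochainComplex (CoarseSheaf X) ℕ) :
    ℕ → (Set X)ᵒᵖ ⥤ AddCommGrpCat.{u}
  -- The leading zero term lets the fibre have `Cⁿ × Iⁿ⁻¹` in degree `n` for `n = 0` too.
  | 0 => (Functor.const _).obj (AddCommGrpCat.of PUnit)
  | n + 1 => (I.X n).obj

/-- The differential of the shifted complex. -/
noncomputable def shiftedD (I : CochainComplex (CoarseSheaf X) ℕ) :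
    ∀ n, shiftedPresheaf I n ⟶ (I.X n).obj
  | 0 => 0
  | n + 1 => (I.d n (n + 1)).hom

theorem hasCoarseGluing_shiftedPresheaf (I : CochainComplex (CoarseSheaf X) ℕ) (n : ℕ) :
    HasCoarseGluing (shiftedPresheaf I n) := by
  cases n with
  | zero => exact ⟨fun _ _ _ _ _ _ => rfl, fun _ _ _ _ _ _ => ⟨PUnit.unit, fun _ => rfl⟩⟩
  | succ n => exact (I.X n).hasCoarseGluing

theorem isFlabby_shiftedPresheaf {I : CochainComplex (CoarseSheaf X) ℕ}
    (hI : ∀ n, IsFlabby (I.X n).obj) (n : ℕ) : IsFlabby (shiftedPresheaf I n) := by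
  cases n with
  | zero => exact fun _ _ _ s => ⟨s, rfl⟩
  | succ n => exact hI n

theorem onSections_d_shiftedD (I : CochainComplex (CoarseSheaf X) ℕ) (n : ℕ) (U : Set X)
    (s : (shiftedPresheaf I n).obj (op U)) :
    onSections (I.d n (n + 1)).hom U (onSections (shiftedD I n) U s) = 0 := by
  cases n with
  | zero => exact map_zero (onSections (I.d 0 1).hom U)
  | succ n => exact onSections_comp_eq_zero (I.d_comp_d n (n + 1) (n + 2)) U s

variable {C I : CochainComplex (CoarseSheaf X) ℕ} (f : C ⟶ I)

/-- The differential of the mapping fibre of a morphism of complexes. -/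
noncomputable def fibreD (n : ℕ) : prodPresheaf (C.X n).obj (shiftedPresheaf I n) ⟶
    prodPresheaf (C.X (n + 1)).obj (I.X n).obj where
  app U := AddCommGrpCat.ofHom
    (((onSections (C.d n (n + 1)).hom U.unop).comp (AddMonoidHom.fst _ _)).prod
      ((onSections (f.f n).hom U.unop).comp (AddMonoidHom.fst _ _) -
        (onSections (shiftedD I n) U.unop).comp (AddMonoidHom.snd _ _)))
  naturality U V g := by
    ext x
    refine Prod.ext ?_ ?_
    · exact onSections_res (C.d n (n + 1)).hom (leOfHom g.unop) x.1
    · refine (congrArg₂ (fun a b => a - b) (onSections_res (f.f n).hom (leOfHom g.unop) x.1)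
        (onSections_res (shiftedD I n) (leOfHom g.unop) x.2)).trans ?_
      exact (map_sub (res (I.X n).obj (leOfHom g.unop)) _ _).symm

theorem onSections_comm (n : ℕ) (U : Set X) (c : (C.X n).obj.obj (op U)) :
    onSections (I.d n (n + 1)).hom U (onSections (f.f n).hom U c) =
      onSections (f.f (n + 1)).hom U (onSections (C.d n (n + 1)).hom U c) :=
  congrArg (fun k => (k.hom.app (op U)).hom c) (f.comm n (n + 1))

/-- A morphism of complexes of flabby sheaves which is locally a quasi-isomorphism has an exact
mapping fibre on sections. -/
theorem exists_fibre_primitive (hC : ∀ n, IsFlabby (C.X n).obj) (hI : ∀ n, IsFlabby (I.X n).obj)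
    (hCex : ∀ n, IsLocallyExact (C.d n (n + 1)).hom (C.d (n + 1) (n + 2)).hom)
    (hIex : ∀ n, IsLocallyExact (I.d n (n + 1)).hom (I.d (n + 1) (n + 2)).hom)
    (hinj : ∀ U (c : (C.X 0).obj.obj (op U)), onSections (C.d 0 1).hom U c = 0 →
      onSections (f.f 0).hom U c = 0 → c = 0)
    (hsurj : ∀ U (e : (I.X 0).obj.obj (op U)), onSections (I.d 0 1).hom U e = 0 →
      ∃ S ∈ coarseTopology X U, ∀ (V : Set X) (i : V ⟶ U), S i → ∃ c : (C.X 0).obj.obj (op V),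
        onSections (C.d 0 1).hom V c = 0 ∧
          onSections (f.f 0).hom V c = res (I.X 0).obj (leOfHom i) e)
    (n : ℕ) (U : Set X) (c : (C.X (n + 1)).obj.obj (op U)) (e : (I.X n).obj.obj (op U))
    (hc : onSections (C.d (n + 1) (n + 2)).hom U c = 0)
    (he : onSections (f.f (n + 1)).hom U c = onSections (I.d n (n + 1)).hom U e) :
    ∃ (b : (C.X n).obj.obj (op U)) (a : (shiftedPresheaf I n).obj (op U)),
      onSections (C.d n (n + 1)).hom U b = c ∧
        onSections (f.f n).hom U b - onSections (shiftedD I n) U a = e := by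
  -- Locally, cocycles of `I` come from cocycles of `C` up to coboundaries: in degree zero by
  -- hypothesis, in positive degree because they are themselves local coboundaries.
  have hloc : ∀ n U (e : (I.X n).obj.obj (op U)), onSections (I.d n (n + 1)).hom U e = 0 →
      ∃ S ∈ coarseTopology X U, ∀ (V : Set X) (i : V ⟶ U), S i →
        ∃ (c : (C.X n).obj.obj (op V)) (a : (shiftedPresheaf I n).obj (op V)),
          onSections (C.d n (n + 1)).hom V c = 0 ∧
          onSections (f.f n).hom V c - onSections (shiftedD I n) V a =
            res (I.X n).obj (leOfHom i) e := by
    intro n U e he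
    cases n with
    | zero =>
      obtain ⟨S, hS, h⟩ := hsurj U e he
      refine ⟨S, hS, fun V i hi => ?_⟩
      obtain ⟨c, hc, hc'⟩ := h V i hi
      exact ⟨c, PUnit.unit, hc, (sub_zero _).trans hc'⟩
    | succ n =>
      obtain ⟨S, hS, h⟩ := hIex n U e he
      refine ⟨S, hS, fun V i hi => ?_⟩
      obtain ⟨a, ha⟩ := h V i hi
      refine ⟨0, -a, map_zero _, ?_⟩
      change onSections (f.f (n + 1)).hom V 0 - onSections (I.d n (n + 1)).hom V (-a) = _
      rw [map_zero, map_neg, zero_sub, neg_neg]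
      exact ha
  have key := exact_sections_of_flabby
    (fun n => prodPresheaf (C.X n).obj (shiftedPresheaf I n)) (fibreD f) ?_
    (fun n => (C.X n).hasCoarseGluing.prod (hasCoarseGluing_shiftedPresheaf I n))
    (fun n => (hC n).prod (isFlabby_shiftedPresheaf hI n)) ?_ ?_ n U (c, e)
    (Prod.ext hc (sub_eq_zero.2 he))
  · obtain ⟨⟨b, a⟩, h⟩ := key
    exact ⟨b, a, congrArg Prod.fst h, congrArg Prod.snd h⟩
  · intro n
    ext U ⟨c, e⟩
    refine Prod.ext ?_ ?_
    · exact onSections_comp_eq_zero (C.d_comp_d n (n + 1) (n + 2)) U.unop c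
    · change onSections (f.f (n + 1)).hom U.unop (onSections (C.d n (n + 1)).hom U.unop c) -
        onSections (I.d n (n + 1)).hom U.unop (onSections (f.f n).hom U.unop c -
          onSections (shiftedD I n) U.unop e) = 0
      rw [map_sub, onSections_comm, onSections_d_shiftedD, sub_zero, sub_self]
  · rintro U ⟨c, e⟩ h
    refine Prod.ext (hinj U c (congrArg Prod.fst h) ?_) rfl
    exact (sub_zero _).symm.trans (congrArg Prod.snd h)
  · rintro n U ⟨c, (e : (I.X n).obj.obj (op U))⟩ h
    have hc : onSections (C.d (n + 1) (n + 2)).hom U c = 0 := congrArg Prod.fst h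
    have he : onSections (f.f (n + 1)).hom U c = onSections (I.d n (n + 1)).hom U e :=
      sub_eq_zero.1 (congrArg Prod.snd h)
    obtain ⟨S, hS, h1⟩ := hCex n U c hc
    choose b hb using h1
    -- For a local primitive `b` of `c`, the defect `f b - e` is a cocycle. On a refinement it
    -- equals `f c' - d a` with `c'` a cocycle, so `(b - c', -a)` is a local primitive of `(c, e)`.
    have hcoc : ∀ V (i : V ⟶ U) (hi : S i), onSections (I.d n (n + 1)).hom V
        (onSections (f.f n).hom V (b V i hi) - res (I.X n).obj (leOfHom i) e) = 0 := by
      intro V i hi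
      rw [map_sub, onSections_comm, hb, onSections_res, onSections_res, he, sub_self]
    choose T hT h2 using fun V i hi => hloc n V _ (hcoc V i hi)
    refine ⟨Sieve.bind S.arrows fun V i hi => T V i hi,
      (coarseTopology X).bind_covering hS fun V i hi => hT V i hi, ?_⟩
    rintro W _ ⟨V, j, i, hi, hj, rfl⟩
    obtain ⟨c', a, hc', ha⟩ := h2 V i hi W j hj
    refine ⟨(res (C.X n).obj (leOfHom j) (b V i hi) - c', -a), Prod.ext ?_ ?_⟩
    · change onSections (C.d n (n + 1)).hom W (res (C.X n).obj (leOfHom j) (b V i hi) - c') =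
        res (C.X (n + 1)).obj _ c
      rw [map_sub, hc', sub_zero, onSections_res, hb, res_res]
    · change onSections (f.f n).hom W (res (C.X n).obj (leOfHom j) (b V i hi) - c') -
        onSections (shiftedD I n) W (-a) = res (I.X n).obj _ e
      rw [map_sub, map_neg, sub_neg_eq_add, onSections_res]
      rw [map_sub, res_res] at ha
      have := sub_eq_iff_eq_add.1 ha
      rw [this]
      abel

end MappingFibre

/-! ### Comparison with an injective resolution -/

section Resolutions

variable {𝒞 : Type*} [Category* 𝒞] [Abelian 𝒞] {F : 𝒞}

/-- The augmentation of an injective resolution. -/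
noncomputable def augmentation (I : InjectiveResolution F) : F ⟶ I.cocomplex.X 0 := I.ι.f 0

instance (I : InjectiveResolution F) : Mono (augmentation I) :=
  inferInstanceAs (Mono (I.ι.f 0))

theorem augmentation_comp_d (I : InjectiveResolution F) :
    augmentation I ≫ I.cocomplex.d 0 1 = 0 :=
  I.ι_f_zero_comp_complex_d

theorem augmentation_exact (I : InjectiveResolution F) :
    (ShortComplex.mk _ _ (augmentation_comp_d I)).Exact :=
  I.exact₀

/-- Any resolution maps to an injective resolution. -/
theorem exists_hom_to_injectiveResolution (C : CochainComplex 𝒞 ℕ) (ε : F ⟶ C.X 0) [Mono ε]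
    (w : ε ≫ C.d 0 1 = 0) (h₀ : (ShortComplex.mk _ _ w).Exact)
    (h : ∀ n, (ShortComplex.mk _ _ (C.d_comp_d n (n + 1) (n + 2))).Exact)
    (I : InjectiveResolution F) :
    ∃ f : C ⟶ I.cocomplex, ε ≫ f.f 0 = augmentation I := by
  have e₀ : ε ≫ Injective.factorThru (augmentation I) ε = augmentation I :=
    Injective.comp_factorThru _ _
  have e₁ := h₀.comp_descToInjective (Injective.factorThru (augmentation I) ε ≫ I.cocomplex.d 0 1)
    (by dsimp; rw [← Category.assoc, e₀, augmentation_comp_d])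
  refine ⟨CochainComplex.mkHom _ _ (Injective.factorThru (augmentation I) ε) _ e₁.symm
    fun n p => ⟨(h n).descToInjective (p.2.1 ≫ I.cocomplex.d (n + 1) (n + 2)) ?_,
      ((h n).comp_descToInjective _ _).symm⟩, ?_⟩
  · dsimp
    rw [← Category.assoc, ← p.2.2, Category.assoc, I.cocomplex.d_comp_d, Limits.comp_zero]
  · rw [CochainComplex.mkHom_f_0, e₀]

end Resolutions

/-! ### Flabby resolutions have the same cohomology of sections -/

section FlabbyResolutions

variable {X : Type u} [MetricSpace X]

/-- The sections of a morphism of complexes of sheaves. -/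
noncomputable abbrev sectionsComplex (U : (Set X)ᵒᵖ) :
    CochainComplex (CoarseSheaf X) ℕ ⥤ CochainComplex AddCommGrpCat.{u} ℕ :=
  ((sheafSections (coarseTopology X) AddCommGrpCat.{u}).obj U).mapHomologicalComplex _

/-- A morphism of flabby resolutions of a sheaf induces isomorphisms on the cohomology of the
complexes of sections. -/
theorem isIso_homologyMap_sections {F : CoarseSheaf X} {C I : CochainComplex (CoarseSheaf X) ℕ}
    (f : C ⟶ I) (hC : ∀ n, IsFlabby (C.X n).obj) (hI : ∀ n, IsFlabby (I.X n).obj)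
    (hCex : ∀ n, (ShortComplex.mk _ _ (C.d_comp_d n (n + 1) (n + 2))).Exact)
    (hIex : ∀ n, (ShortComplex.mk _ _ (I.d_comp_d n (n + 1) (n + 2))).Exact)
    (ε : F ⟶ C.X 0) (ι : F ⟶ I.X 0) [Mono ε] [Mono ι] (hει : ε ≫ f.f 0 = ι)
    (wC : ε ≫ C.d 0 1 = 0) (wI : ι ≫ I.d 0 1 = 0) (hC₀ : (ShortComplex.mk _ _ wC).Exact)
    (hI₀ : (ShortComplex.mk _ _ wI).Exact) (U : (Set X)ᵒᵖ) (n : ℕ) :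
    IsIso (HomologicalComplex.homologyMap ((sectionsComplex U).map f) n) := by
  obtain ⟨U⟩ := U
  have hf : ∀ U s, onSections (f.f 0).hom U (onSections ε.hom U s) = onSections ι.hom U s :=
    fun U s => congrArg (fun k => (k.hom.app (op U)).hom s) hει
  -- By left exactness the degree-zero cocycles over `U` of both complexes are the sections of `F`,
  -- and `f` respects the augmentations.
  have hinj : ∀ U (c : (C.X 0).obj.obj (op U)), onSections (C.d 0 1).hom U c = 0 →
      onSections (f.f 0).hom U c = 0 → c = 0 := by
    intro U c hc hfc
    obtain ⟨s, rfl⟩ := sections_exact_of_mono hC₀ inferInstance U c hc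
    have hs : s = 0 := onSections_injective ι U (((hf U s).symm.trans hfc).trans (map_zero _).symm)
    rw [hs, map_zero]
  have hsurj : ∀ U (e : (I.X 0).obj.obj (op U)), onSections (I.d 0 1).hom U e = 0 →
      ∃ c : (C.X 0).obj.obj (op U), onSections (C.d 0 1).hom U c = 0 ∧
        onSections (f.f 0).hom U c = e := by
    intro U e he
    obtain ⟨s, rfl⟩ := sections_exact_of_mono hI₀ inferInstance U e he
    exact ⟨onSections ε.hom U s, onSections_comp_eq_zero wC U s, hf U s⟩
  have key := exists_fibre_primitive f hC hI (fun n => (exact_iff_isLocallyExact _).1 (hCex n))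
    (fun n => (exact_iff_isLocallyExact _).1 (hIex n)) hinj fun U e he =>
      ⟨⊤, (coarseTopology X).top_mem U, fun V i _ => hsurj V _ (by
        rw [onSections_res, he, map_zero])⟩
  -- A fibre primitive of `(0, e)` writes the cocycle `e` as the image of a cocycle up to a
  -- coboundary. In positive degree, injectivity comes from a fibre primitive of `(x, w)`.
  have hsurj' : ∀ n (e : (I.X n).obj.obj (op U)), onSections (I.d n (n + 1)).hom U e = 0 →
      ∃ (b : (C.X n).obj.obj (op U)) (a : (shiftedPresheaf I n).obj (op U)),
        onSections (C.d n (n + 1)).hom U b = 0 ∧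
          onSections (f.f n).hom U b - onSections (shiftedD I n) U a = e := fun n e he =>
    key n U 0 e (map_zero _) ((map_zero _).trans he.symm)
  cases n with
  | zero =>
    -- In `ComplexShape.up ℕ` the predecessor of `0` is `0` itself, with zero differential, so `w`
    -- contributes nothing.
    refine isIso_homologyMap_of_elements _ (i := 0) (k := 1) (by simp) (by simp) ?_ ?_
    · intro x w hx hw
      refine ⟨0, (map_zero _).trans (hinj U x hx (hw.trans ?_)).symm⟩
      exact congrArg (fun k => (k.hom.app (op U)).hom w) (I.shape 0 0 (by simp))
    · intro y hy
      obtain ⟨x, hx, hxy⟩ := hsurj U y hy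
      refine ⟨x, 0, hx, ?_⟩
      exact (congrArg (fun a => onSections (f.f 0).hom U x + a)
        (map_zero (onSections (I.d 0 0).hom U))).trans ((add_zero _).trans hxy)
  | succ n =>
    refine isIso_homologyMap_of_elements _ (i := n) (k := n + 2) (by simp) (by simp) ?_ ?_
    · intro x w hx hw
      obtain ⟨b, _, hb, _⟩ := key n U x w hx hw
      exact ⟨b, hb⟩
    · intro y hy
      obtain ⟨x, w, hx, hw⟩ := hsurj' (n + 1) y hy
      refine ⟨x, -w, hx, ?_⟩
      refine (congrArg (fun a => onSections (f.f (n + 1)).hom U x + a)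
        (map_neg (onSections (I.d n (n + 1)).hom U) w)).trans ?_
      exact (sub_eq_add_neg _ _).symm.trans hw

end FlabbyResolutions

/-! ### Coarse cochains resolve the constant sheaf and compute its cohomology -/

section CochainResolution

variable (X : Type u) [MetricSpace X] (A : Type u) [AddCommGroup A]

/-- The sheaf `U ↦ CY_b^q(U; A)`. -/
def cochainSheaf (q : ℕ) : CoarseSheaf X :=
  ⟨cochainPresheaf X A q, (hasCoarseGluing_cochainPresheaf q).isSheaf⟩

/-- The complex of sheaves `U ↦ CY_b^*(U; A)`. -/
def cochainSheafComplex : CochainComplex (CoarseSheaf X) ℕ where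
  X q := cochainSheaf X A q
  d q r := ⟨cochainPresheafD X A q r⟩
  shape q r h := by
    ext U : 3
    exact ((coarseCochainPresheaf X A).obj U).shape q r h
  d_comp_d' p q r _ _ := by
    ext U : 3
    exact ((coarseCochainPresheaf X A).obj U).d_comp_d p q r

/-- The inclusion of the constant functions. -/
def constantCochains : (Functor.const (Set X)ᵒᵖ).obj (AddCommGrpCat.of A) ⟶
    cochainPresheaf X A 0 where
  app _ := AddCommGrpCat.ofHom
    { toFun := fun a => cochainClass (fun _ => a) (isBlocky_const a)
      map_zero' := rfl
      map_add' := fun _ _ => rfl }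
  naturality _ _ _ := rfl

/-- The morphism from the constant sheaf induced by the inclusion of the constant functions. -/
noncomputable def constantSheafToCochains :
    sheafify (coarseTopology X) ((Functor.const (Set X)ᵒᵖ).obj (AddCommGrpCat.of A)) ⟶
      cochainPresheaf X A 0 :=
  sheafifyLift (coarseTopology X) (constantCochains X A) (cochainSheaf X A 0).property

theorem toSheafify_constantSheafToCochains :
    toSheafify (coarseTopology X) ((Functor.const (Set X)ᵒᵖ).obj (AddCommGrpCat.of A)) ≫
      constantSheafToCochains X A = constantCochains X A :=
  toSheafify_sheafifyLift _ _ _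

/-- The augmentation of the complex of sheaves of cochains. -/
noncomputable def cochainAugmentation : coarseConstantSheaf X A ⟶ (cochainSheafComplex X A).X 0 :=
  ⟨constantSheafToCochains X A⟩

theorem mem_coarseTopology_of_isBounded {U : Set X} (hU : Bornology.IsBounded U) (S : Sieve U) :
    S ∈ coarseTopology X U :=
  ⟨0, Fin.elim0, isCoarseCover_zero hU _, fun i => i.elim0⟩

/-- Distinct constants have the same class only over a bounded set, and there every sieve is
covering. -/
instance : Mono (cochainAugmentation X A) := by
  have : Presheaf.IsLocallyInjective (coarseTopology X) (constantCochains X A) := by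
    refine ⟨fun {U} a b hab => ?_⟩
    by_cases h : a = b
    · subst h
      rw [Presheaf.equalizerSieve_self_eq_top]
      exact (coarseTopology X).top_mem _
    · refine mem_coarseTopology_of_isBounded X (isBounded_of_cochainClass_const_eq_zero (A := A)
        (a := a - b) (sub_ne_zero.2 h) ?_) _
      exact sub_eq_zero.2 hab
  -- Local injectivity passes to the sheafification, onto which the constant presheaf is locally
  -- surjective.
  have : Presheaf.IsLocallyInjective (coarseTopology X) (constantSheafToCochains X A) :=
    Presheaf.isLocallyInjective_of_isLocallyInjective_of_isLocallySurjective_fac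
      (coarseTopology X) (constantCochains X A) (toSheafify_constantSheafToCochains X A)
  have : Sheaf.IsLocallyInjective (cochainAugmentation X A) := this
  exact Sheaf.mono_of_isLocallyInjective _

theorem cochainAugmentation_comp_d :
    cochainAugmentation X A ≫ (cochainSheafComplex X A).d 0 1 = 0 := by
  ext : 1
  refine sheafify_hom_ext (coarseTopology X) _ _ (cochainSheaf X A 1).property ?_
  change toSheafify _ _ ≫ constantSheafToCochains X A ≫ cochainPresheafD X A 0 1 =
    toSheafify _ _ ≫ 0
  rw [← Category.assoc, toSheafify_constantSheafToCochains, Limits.comp_zero]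
  ext U (a : A)
  refine (cochainPresheafD_cochainClass (X := X) (A := A) (q := 0) (U := U.unop)
    (fun _ => a) (isBlocky_const _)).trans ?_
  refine cochainClass_eq_zero_iff.2 ?_
  have : {x : Fin 2 → U.unop | coboundaryFun 0 (fun _ => (a : A)) x ≠ 0} = ∅ := by
    ext x
    have : coboundaryFun 0 (fun _ => (a : A)) x = 0 := by
      change (∑ k : Fin 2, (-1 : ℤ) ^ (k : ℕ) • (a : A)) = 0
      simp [Fin.sum_univ_two]
    simp [this]
  intro R k
  refine Bornology.isBounded_empty.subset ?_
  rintro _ ⟨x, ⟨hx, -⟩, -⟩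
  exact this.subset hx

theorem cochainAugmentation_exact :
    (ShortComplex.mk _ _ (cochainAugmentation_comp_d X A)).Exact := by
  rw [exact_iff_isLocallyExact]
  intro U s hs
  obtain ⟨S, hS, h⟩ := exists_cover_const s hs
  refine ⟨S, hS, fun V i hi => ?_⟩
  obtain ⟨a, ha⟩ := h V i hi
  refine ⟨onSections (toSheafify (coarseTopology X)
    ((Functor.const (Set X)ᵒᵖ).obj (AddCommGrpCat.of A))) V a, Eq.trans ?_ ha⟩
  exact congrArg (fun k => (k.app (op V)).hom a) (toSheafify_constantSheafToCochains X A)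

theorem cochainSheafComplex_exact (n : ℕ) :
    (ShortComplex.mk _ _ ((cochainSheafComplex X A).d_comp_d n (n + 1) (n + 2))).Exact := by
  rw [exact_iff_isLocallyExact]
  exact isLocallyExact_cochainPresheafD n

/-- The formal part of naturality for the comparison isomorphism below: pasting squares along
isomorphisms. -/
theorem transport_square {𝒞 : Type*} [Category* 𝒞] {P P' H H' K K' : 𝒞} (a : P ≅ H) (a' : P' ≅ H')
    (e : K ≅ H) (e' : K' ≅ H') (m : H ⟶ H') (k : K ⟶ K') (h : k ≫ e'.hom = e.hom ≫ m) :
    (a.hom ≫ m ≫ a'.inv) ≫ (a' ≪≫ e'.symm).hom = (a ≪≫ e.symm).hom ≫ k := by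
  simp only [Iso.trans_hom, Iso.symm_hom, Category.assoc, Iso.inv_hom_id_assoc]
  rw [Iso.cancel_iso_hom_left, Iso.comp_inv_eq, Category.assoc, h, Iso.inv_hom_id_assoc]

/-- Sheaf cohomology is the cohomology of the complexes of blocky cochains, naturally in the
subset. -/
theorem nonempty_iso_sheafCohomology (q : ℕ) : Nonempty (coarseSheafCohomology X A q ≅
    coarseCochainPresheaf X A ⋙ HomologicalComplex.homologyFunctor _ _ q) := by
  let I := injectiveResolution (coarseConstantSheaf X A)
  obtain ⟨f, hf⟩ := exists_hom_to_injectiveResolution (cochainSheafComplex X A)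
    (cochainAugmentation X A) (cochainAugmentation_comp_d X A) (cochainAugmentation_exact X A)
    (cochainSheafComplex_exact X A) I
  have hiso := isIso_homologyMap_sections f (fun n => isFlabby_cochainPresheaf n)
    (fun n => isFlabby_of_injective _) (cochainSheafComplex_exact X A) I.exact_succ
    (cochainAugmentation X A) (augmentation I) hf (cochainAugmentation_comp_d X A)
    (augmentation_comp_d I) (cochainAugmentation_exact X A) (augmentation_exact I)
  let Γ := sheafSections (coarseTopology X) AddCommGrpCat.{u}
  -- The complex of sections of `cochainSheafComplex` over `U` is by definition the complex of
  -- cochains of `U`.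
  let τ : ∀ U : (Set X)ᵒᵖ, (coarseCochainPresheaf X A).obj U ⟶
    (sectionsComplex U).obj I.cocomplex := fun U => (sectionsComplex U).map f
  have hτ : ∀ U, IsIso (HomologicalComplex.homologyMap (τ U) q) := fun U => hiso U q
  -- One morphism `f` of complexes of sheaves serves all subsets, so compatibility with restriction
  -- is its naturality.
  have hnat : ∀ {U V : (Set X)ᵒᵖ} (g : U ⟶ V), (coarseCochainPresheaf X A).map g ≫ τ V =
      τ U ≫ (NatTrans.mapHomologicalComplex (Γ.map g) _).app I.cocomplex := by
    intro U V g
    ext n : 1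
    exact (f.f n).hom.naturality g
  refine ⟨NatIso.ofComponents (fun U => I.isoRightDerivedObj (Γ.obj U) q ≪≫
    (asIso (HomologicalComplex.homologyMap (τ U) q)).symm) fun {U V} g => ?_⟩
  refine Eq.trans (congrArg (fun k => k ≫ _) (I.rightDerived_app_eq (Γ.map g) q)) ?_
  refine transport_square (I.isoRightDerivedObj (Γ.obj U) q) (I.isoRightDerivedObj (Γ.obj V) q)
    (@asIso _ _ _ _ _ (hτ U)) (@asIso _ _ _ _ _ (hτ V)) _ _ ?_
  refine (HomologicalComplex.homologyMap_comp _ _ q).symm.trans ?_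
  rw [hnat]
  exact HomologicalComplex.homologyMap_comp _ _ q

end CochainResolution

/-! ### Elements and cohomology of direct sums of complexes -/

section BiproductComplexes

open Limits HomologicalComplex

variable {K L M : CochainComplex AddCommGrpCat.{u} ℕ}

theorem biprod_ext_f {q : ℕ} {x y : (K ⊞ L).X q}
    (h₁ : ((biprod.fst : K ⊞ L ⟶ K).f q).hom x = ((biprod.fst : K ⊞ L ⟶ K).f q).hom y)
    (h₂ : ((biprod.snd : K ⊞ L ⟶ L).f q).hom x = ((biprod.snd : K ⊞ L ⟶ L).f q).hom y) :
    x = y := by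
  have h (z : (K ⊞ L).X q) : z =
      ((biprod.inl : K ⟶ K ⊞ L).f q).hom (((biprod.fst : K ⊞ L ⟶ K).f q).hom z) +
        ((biprod.inr : L ⟶ K ⊞ L).f q).hom (((biprod.snd : K ⊞ L ⟶ L).f q).hom z) :=
    congrArg (fun k => (k.f q).hom z) (biprod.total (X := K) (Y := L)).symm
  rw [h x, h y, h₁, h₂]

theorem biprod_lift_fst_f_apply (a : M ⟶ K) (b : M ⟶ L) (q : ℕ) (x : M.X q) :
    ((biprod.fst : K ⊞ L ⟶ K).f q).hom (((biprod.lift a b).f q).hom x) = (a.f q).hom x :=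
  congrArg (fun k => (k.f q).hom x) (biprod.lift_fst a b)

theorem biprod_lift_snd_f_apply (a : M ⟶ K) (b : M ⟶ L) (q : ℕ) (x : M.X q) :
    ((biprod.snd : K ⊞ L ⟶ L).f q).hom (((biprod.lift a b).f q).hom x) = (b.f q).hom x :=
  congrArg (fun k => (k.f q).hom x) (biprod.lift_snd a b)

theorem biprod_desc_f_apply (a : K ⟶ M) (b : L ⟶ M) (q : ℕ) (x : (K ⊞ L).X q) :
    ((biprod.desc a b).f q).hom x = (a.f q).hom (((biprod.fst : K ⊞ L ⟶ K).f q).hom x) +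
      (b.f q).hom (((biprod.snd : K ⊞ L ⟶ L).f q).hom x) :=
  congrArg (fun k => (k.f q).hom x) (biprod.desc_eq (f := a) (g := b))

theorem biprod_exists_f {q : ℕ} (x : K.X q) (y : L.X q) : ∃ z : (K ⊞ L).X q,
    ((biprod.fst : K ⊞ L ⟶ K).f q).hom z = x ∧ ((biprod.snd : K ⊞ L ⟶ L).f q).hom z = y := by
  have h₁₁ : ((biprod.fst : K ⊞ L ⟶ K).f q).hom (((biprod.inl : K ⟶ K ⊞ L).f q).hom x) = x :=
    congrArg (fun k => (k.f q).hom x) (biprod.inl_fst (X := K) (Y := L))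
  have h₁₂ : ((biprod.snd : K ⊞ L ⟶ L).f q).hom (((biprod.inl : K ⟶ K ⊞ L).f q).hom x) = 0 :=
    congrArg (fun k => (k.f q).hom x) (biprod.inl_snd (X := K) (Y := L))
  have h₂₁ : ((biprod.fst : K ⊞ L ⟶ K).f q).hom (((biprod.inr : L ⟶ K ⊞ L).f q).hom y) = 0 :=
    congrArg (fun k => (k.f q).hom y) (biprod.inr_fst (X := K) (Y := L))
  have h₂₂ : ((biprod.snd : K ⊞ L ⟶ L).f q).hom (((biprod.inr : L ⟶ K ⊞ L).f q).hom y) = y :=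
    congrArg (fun k => (k.f q).hom y) (biprod.inr_snd (X := K) (Y := L))
  refine ⟨((biprod.inl : K ⟶ K ⊞ L).f q).hom x + ((biprod.inr : L ⟶ K ⊞ L).f q).hom y, ?_, ?_⟩
  · rw [map_add, h₁₁, h₂₁, add_zero]
  · rw [map_add, h₁₂, h₂₂, zero_add]

theorem homologyMap_comp_apply (f : K ⟶ L) (g : L ⟶ M) (q : ℕ) (x : K.homology q) :
    (homologyMap (f ≫ g) q).hom x = (homologyMap g q).hom ((homologyMap f q).hom x) :=
  congrArg (fun k => k.hom x) (homologyMap_comp f g q)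

theorem homologyMap_add_apply (f g : K ⟶ L) (q : ℕ) (x : K.homology q) :
    (homologyMap (f + g) q).hom x = (homologyMap f q).hom x + (homologyMap g q).hom x :=
  congrArg (fun k => k.hom x) (homologyMap_add f g q)

theorem homologyMap_neg_apply (f : K ⟶ L) (q : ℕ) (x : K.homology q) :
    (homologyMap (-f) q).hom x = -(homologyMap f q).hom x :=
  congrArg (fun k => k.hom x) (homologyMap_neg f q)

theorem homologyMap_id_apply (q : ℕ) (x : K.homology q) : (homologyMap (𝟙 K) q).hom x = x :=
  congrArg (fun k => k.hom x) (homologyMap_id K q)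

theorem homologyMap_zero_apply (q : ℕ) (x : K.homology q) :
    (homologyMap (0 : K ⟶ L) q).hom x = 0 :=
  congrArg (fun k => k.hom x) (homologyMap_zero K L q)

variable (K L)

/-- The cohomology of a direct sum of complexes. -/
noncomputable def homologyBiprodEquiv (q : ℕ) :
    (K ⊞ L).homology q ≃+ K.homology q × L.homology q where
  toFun z := ((homologyMap (biprod.fst : K ⊞ L ⟶ K) q).hom z,
    (homologyMap (biprod.snd : K ⊞ L ⟶ L) q).hom z)
  invFun p := (homologyMap (biprod.inl : K ⟶ K ⊞ L) q).hom p.1 +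
    (homologyMap (biprod.inr : L ⟶ K ⊞ L) q).hom p.2
  left_inv z := by
    dsimp only
    rw [← homologyMap_comp_apply, ← homologyMap_comp_apply, ← homologyMap_add_apply, biprod.total,
      homologyMap_id_apply]
  right_inv p := by
    refine Prod.ext ?_ ?_
    · dsimp only
      rw [map_add, ← homologyMap_comp_apply, ← homologyMap_comp_apply, biprod.inl_fst,
        biprod.inr_fst, homologyMap_id_apply, homologyMap_zero_apply, add_zero]
    · dsimp only
      rw [map_add, ← homologyMap_comp_apply, ← homologyMap_comp_apply, biprod.inl_snd,
        biprod.inr_snd, homologyMap_id_apply, homologyMap_zero_apply, zero_add]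
  map_add' z w := by simp only [map_add, Prod.mk_add_mk]

variable {K L}

theorem homologyBiprodEquiv_lift (a : M ⟶ K) (b : M ⟶ L) (q : ℕ) (x : M.homology q) :
    homologyBiprodEquiv K L q ((homologyMap (biprod.lift a b) q).hom x) =
      ((homologyMap a q).hom x, (homologyMap b q).hom x) := by
  refine Prod.ext ?_ ?_
  · exact (homologyMap_comp_apply _ _ q x).symm.trans (by rw [biprod.lift_fst])
  · exact (homologyMap_comp_apply _ _ q x).symm.trans (by rw [biprod.lift_snd])

theorem homologyMap_desc_apply (a : K ⟶ M) (b : L ⟶ M) (q : ℕ) (z : (K ⊞ L).homology q) :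
    (homologyMap (biprod.desc a b) q).hom z =
      (homologyMap a q).hom (homologyBiprodEquiv K L q z).1 +
        (homologyMap b q).hom (homologyBiprodEquiv K L q z).2 := by
  rw [biprod.desc_eq, homologyMap_add_apply, homologyMap_comp_apply, homologyMap_comp_apply]
  rfl

/-- In degree zero a monomorphism of complexes induces an injective map on cohomology. -/
theorem homologyMap_zero_injective (g : K ⟶ L) (hg : Function.Injective (g.f 0).hom) :
    Function.Injective (homologyMap g 0).hom := by
  rw [injective_iff_map_eq_zero]
  intro x hx
  obtain ⟨z, rfl⟩ := homologyπ_surjective 0 x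
  have h : (L.homologyπ 0).hom ((cyclesMap g 0).hom z) = 0 :=
    (congrArg (fun f => f.hom z) (homologyπ_naturality g 0)).symm.trans hx
  -- Here `w` again has degree zero, where the incoming differential is zero: there are no nonzero
  -- coboundaries.
  obtain ⟨w, hw⟩ := exists_toCycles_eq (CochainComplex.prev_nat_zero) _ h
  have hz : (g.f 0).hom ((K.iCycles 0).hom z) = 0 := by
    refine (congrArg (fun f => f.hom z) (cyclesMap_i g 0)).symm.trans ?_
    refine (congrArg (L.iCycles 0).hom hw.symm).trans ?_
    rw [iCycles_toCycles, L.shape _ _ (by simp)]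
    rfl
  have : z = 0 := iCycles_injective 0 (by rw [map_zero]; exact hg (hz.trans (map_zero _).symm))
  rw [this, map_zero]

end BiproductComplexes

/-! ### The short exact sequence of cochain complexes -/

section MayerVietoris

variable {X : Type u} [MetricSpace X] (A : Type u) [AddCommGroup A] {U₁ U₂ : Set X}

/-- Injectivity and middle exactness are the two halves of the sheaf condition for the cover;
surjectivity is flabbiness. -/
theorem shortExact_mayerVietorisShortComplex (hU : IsCoarseCover Set.univ ![U₁, U₂]) :
    (mayerVietorisShortComplex X A U₁ U₂).ShortExact := by
  refine HomologicalComplex.shortExact_of_degreewise_shortExact _ fun q => ?_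
  let P := cochainPresheaf X A q
  have hP : HasCoarseGluing P := hasCoarseGluing_cochainPresheaf q
  have hf₁ (x) : ((Limits.biprod.fst :
      (coarseCochainPresheaf X A).obj (op U₁) ⊞ (coarseCochainPresheaf X A).obj (op U₂) ⟶ _).f
        q).hom (((mayerVietorisShortComplex X A U₁ U₂).f.f q).hom x) =
          res P (Set.subset_univ U₁) x := biprod_lift_fst_f_apply _ _ q x
  have hf₂ (x) : ((Limits.biprod.snd :
      (coarseCochainPresheaf X A).obj (op U₁) ⊞ (coarseCochainPresheaf X A).obj (op U₂) ⟶ _).f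
        q).hom (((mayerVietorisShortComplex X A U₁ U₂).f.f q).hom x) =
          res P (Set.subset_univ U₂) x := biprod_lift_snd_f_apply _ _ q x
  have hg (x) : ((mayerVietorisShortComplex X A U₁ U₂).g.f q).hom x =
      -res P (Set.inter_subset_left : U₁ ∩ U₂ ⊆ U₁) (((Limits.biprod.fst :
        (coarseCochainPresheaf X A).obj (op U₁) ⊞ (coarseCochainPresheaf X A).obj (op U₂) ⟶ _).f
          q).hom x) +
      res P (Set.inter_subset_right : U₁ ∩ U₂ ⊆ U₂) (((Limits.biprod.snd :
        (coarseCochainPresheaf X A).obj (op U₁) ⊞ (coarseCochainPresheaf X A).obj (op U₂) ⟶ _).f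
          q).hom x) := biprod_desc_f_apply _ _ q x
  refine ShortComplex.ShortExact.mk' ?_ ?_ ?_
  · rw [ShortComplex.ab_exact_iff]
    intro x hx
    obtain ⟨s, hs₁, hs₂⟩ := hP.glue_pair hU _ _ (neg_add_eq_zero.1 ((hg x).symm.trans hx))
    exact ⟨s, biprod_ext_f ((hf₁ s).trans hs₁) ((hf₂ s).trans hs₂)⟩
  · refine (AddCommGrpCat.mono_iff_injective _).2 fun x y hxy => ?_
    refine hP.eq_of_pair hU x y ?_ ?_
    · exact (hf₁ x).symm.trans ((congrArg _ hxy).trans (hf₁ y))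
    · exact (hf₂ x).symm.trans ((congrArg _ hxy).trans (hf₂ y))
  · refine (AddCommGrpCat.epi_iff_surjective _).2 fun y => ?_
    obtain ⟨t, ht⟩ := isFlabby_cochainPresheaf (X := X) (A := A) q
      (Set.inter_subset_right : U₁ ∩ U₂ ⊆ U₂) y
    -- Extending `y` to `U₂` alone suffices, with zero on `U₁`.
    obtain ⟨z, hz₁, hz₂⟩ := biprod_exists_f (K := (coarseCochainPresheaf X A).obj (op U₁))
      (L := (coarseCochainPresheaf X A).obj (op U₂)) (q := q) 0 t
    have h₀ : res P (Set.inter_subset_left : U₁ ∩ U₂ ⊆ U₁) 0 = 0 := map_zero _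
    refine ⟨z, (hg z).trans ((congrArg₂ (fun a b => -a + b)
      ((congrArg (res P Set.inter_subset_left) hz₁).trans h₀)
      ((congrArg (res P Set.inter_subset_right) hz₂).trans ht)).trans ?_)⟩
    exact (congrArg (· + y) neg_zero).trans (zero_add y)

end MayerVietoris

/-! ### Transport of the long exact sequence to sheaf cohomology -/

section LongExactSequence

variable {X : Type u} [MetricSpace X] {A : Type u} [AddCommGroup A] (U₁ U₂ : Set X) {q : ℕ}
  (θ : coarseSheafCohomology X A q ≅
    coarseCochainPresheaf X A ⋙ HomologicalComplex.homologyFunctor _ _ q)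

/-- The component at a subset of an isomorphism between sheaf cohomology and the cohomology of
cochains. -/
noncomputable def cohomologyEquiv (U : Set X) : (coarseSheafCohomology X A q).obj (op U) ≃+
    ((coarseCochainPresheaf X A).obj (op U)).homology q :=
  (θ.app (op U)).addCommGroupIsoToAddEquiv

theorem cohomologyEquiv_restrict {U V : Set X} (h : U ⊆ V)
    (x : (coarseSheafCohomology X A q).obj (op V)) :
    cohomologyEquiv θ U (cohomologyRestrict X A q h x) =
      (HomologicalComplex.homologyMap ((coarseCochainPresheaf X A).map (homOfLE h).op) q).hom
        (cohomologyEquiv θ V x) :=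
  congrArg (fun k => k.hom x) (θ.hom.naturality (homOfLE h).op)

/-- The middle vertical isomorphism between the two Mayer–Vietoris sequences. -/
noncomputable def cohomologyProdEquiv : (coarseSheafCohomology X A q).obj (op U₁) ×
    (coarseSheafCohomology X A q).obj (op U₂) ≃+
      (mayerVietorisShortComplex X A U₁ U₂).X₂.homology q :=
  ((cohomologyEquiv θ U₁).prodCongr (cohomologyEquiv θ U₂)).trans
    (homologyBiprodEquiv ((coarseCochainPresheaf X A).obj (op U₁))
      ((coarseCochainPresheaf X A).obj (op U₂)) q).symm

theorem homologyBiprodEquiv_cohomologyProdEquiv (p : (coarseSheafCohomology X A q).obj (op U₁) ×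
    (coarseSheafCohomology X A q).obj (op U₂)) :
    homologyBiprodEquiv ((coarseCochainPresheaf X A).obj (op U₁))
      ((coarseCochainPresheaf X A).obj (op U₂)) q (cohomologyProdEquiv U₁ U₂ θ p) =
        (cohomologyEquiv θ U₁ p.1, cohomologyEquiv θ U₂ p.2) :=
  (homologyBiprodEquiv ((coarseCochainPresheaf X A).obj (op U₁))
      ((coarseCochainPresheaf X A).obj (op U₂)) q).apply_symm_apply _

theorem homologyMap_f_cohomologyEquiv (x : (coarseSheafCohomology X A q).obj (op Set.univ)) :
    (HomologicalComplex.homologyMap (mayerVietorisShortComplex X A U₁ U₂).f q).hom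
      (cohomologyEquiv θ Set.univ x) =
        cohomologyProdEquiv U₁ U₂ θ (mayerVietorisRestrict X A q U₁ U₂ x) := by
  refine (homologyBiprodEquiv ((coarseCochainPresheaf X A).obj (op U₁))
    ((coarseCochainPresheaf X A).obj (op U₂)) q).injective ?_
  rw [homologyBiprodEquiv_cohomologyProdEquiv]
  refine (homologyBiprodEquiv_lift _ _ q _).trans (Prod.ext ?_ ?_)
  · exact (cohomologyEquiv_restrict θ _ x).symm
  · exact (cohomologyEquiv_restrict θ _ x).symm

theorem homologyMap_g_cohomologyProdEquiv (p : (coarseSheafCohomology X A q).obj (op U₁) ×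
    (coarseSheafCohomology X A q).obj (op U₂)) :
    (HomologicalComplex.homologyMap (mayerVietorisShortComplex X A U₁ U₂).g q).hom
      (cohomologyProdEquiv U₁ U₂ θ p) =
        cohomologyEquiv θ (U₁ ∩ U₂) (mayerVietorisDiff X A q U₁ U₂ p) := by
  refine (homologyMap_desc_apply _ _ q _).trans ?_
  rw [homologyBiprodEquiv_cohomologyProdEquiv]
  refine (congrArg₂ (· + ·) ((homologyMap_neg_apply _ q _).trans
    (congrArg (-·) (cohomologyEquiv_restrict θ _ p.1).symm))
    (cohomologyEquiv_restrict θ _ p.2).symm).trans ?_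
  exact (neg_add_eq_sub _ _).trans (map_sub (cohomologyEquiv θ (U₁ ∩ U₂)) _ _).symm

/-- The two commuting squares above carry exactness of the homology sequence across the vertical
isomorphisms. The exactness statements for the connecting map follow the same pattern. -/
theorem exact_mayerVietorisRestrict_mayerVietorisDiff (θ : coarseSheafCohomology X A q ≅
    coarseCochainPresheaf X A ⋙ HomologicalComplex.homologyFunctor _ _ q)
    (hS : (mayerVietorisShortComplex X A U₁ U₂).ShortExact) :
    Function.Exact (mayerVietorisRestrict X A q U₁ U₂) (mayerVietorisDiff X A q U₁ U₂) := by
  intro p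
  have h := (ShortComplex.ab_exact_iff_function_exact _).1 (hS.homology_exact₂ q)
    (cohomologyProdEquiv U₁ U₂ θ p)
  refine Iff.trans ?_ (h.trans ?_)
  · refine Iff.trans ?_ (Eq.congr_left (homologyMap_g_cohomologyProdEquiv U₁ U₂ θ p).symm)
    exact (map_eq_zero_iff _ (cohomologyEquiv θ _).injective).symm
  · constructor
    · rintro ⟨x, hx⟩
      refine ⟨(cohomologyEquiv θ Set.univ).symm x, (cohomologyProdEquiv U₁ U₂ θ).injective ?_⟩
      refine (homologyMap_f_cohomologyEquiv U₁ U₂ θ _).symm.trans (Eq.trans ?_ hx)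
      exact congrArg _ ((cohomologyEquiv θ _).apply_symm_apply x)
    · rintro ⟨x, rfl⟩
      exact ⟨cohomologyEquiv θ Set.univ x, homologyMap_f_cohomologyEquiv U₁ U₂ θ x⟩

theorem mayerVietorisRestrict_zero_injective (θ : coarseSheafCohomology X A 0 ≅
    coarseCochainPresheaf X A ⋙ HomologicalComplex.homologyFunctor _ _ 0)
    (hS : (mayerVietorisShortComplex X A U₁ U₂).ShortExact) :
    Function.Injective (mayerVietorisRestrict X A 0 U₁ U₂) := by
  have hmono := (HomologicalComplex.shortExact_iff_degreewise_shortExact _).1 hS 0 |>.mono_f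
  intro x y h
  refine (cohomologyEquiv θ Set.univ).injective
    (homologyMap_zero_injective (mayerVietorisShortComplex X A U₁ U₂).f
      ((AddCommGrpCat.mono_iff_injective _).1 hmono) ?_)
  exact (homologyMap_f_cohomologyEquiv U₁ U₂ θ x).trans
    ((congrArg _ h).trans (homologyMap_f_cohomologyEquiv U₁ U₂ θ y).symm)

variable {U₁ U₂} (θ' : coarseSheafCohomology X A (q + 1) ≅
    coarseCochainPresheaf X A ⋙ HomologicalComplex.homologyFunctor _ _ (q + 1))
  (hS : (mayerVietorisShortComplex X A U₁ U₂).ShortExact)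

/-- The connecting homomorphism of the Mayer–Vietoris sequence. -/
noncomputable def mayerVietorisδ : (coarseSheafCohomology X A q).obj (op (U₁ ∩ U₂)) ⟶
    (coarseSheafCohomology X A (q + 1)).obj (op Set.univ) :=
  θ.hom.app (op (U₁ ∩ U₂)) ≫ hS.δ q (q + 1) rfl ≫ θ'.inv.app (op Set.univ)

theorem mayerVietorisδ_comp : mayerVietorisδ θ θ' hS ≫ θ'.hom.app (op Set.univ) =
    θ.hom.app (op (U₁ ∩ U₂)) ≫ hS.δ q (q + 1) rfl := by
  have h : θ'.inv.app (op Set.univ) ≫ θ'.hom.app (op Set.univ) = 𝟙 _ :=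
    θ'.inv_hom_id_app (op Set.univ)
  refine (Category.assoc _ _ _).trans (congrArg (θ.hom.app (op (U₁ ∩ U₂)) ≫ ·) ?_)
  exact (Category.assoc _ _ _).trans
    ((congrArg (hS.δ q (q + 1) rfl ≫ ·) h).trans (Category.comp_id _))

theorem cohomologyEquiv_mayerVietorisδ (x : (coarseSheafCohomology X A q).obj (op (U₁ ∩ U₂))) :
    cohomologyEquiv θ' Set.univ ((mayerVietorisδ θ θ' hS).hom x) =
      (hS.δ q (q + 1) rfl).hom (cohomologyEquiv θ (U₁ ∩ U₂) x) :=
  congrArg (fun k => k.hom x) (mayerVietorisδ_comp θ θ' hS)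

theorem exact_mayerVietorisDiff_mayerVietorisδ :
    Function.Exact (mayerVietorisDiff X A q U₁ U₂) (mayerVietorisδ θ θ' hS).hom := by
  intro x
  have h := (ShortComplex.ab_exact_iff_function_exact _).1 (hS.homology_exact₃ q (q + 1) rfl)
    (cohomologyEquiv θ (U₁ ∩ U₂) x)
  refine Iff.trans ?_ (h.trans ?_)
  · refine Iff.trans ?_ (Eq.congr_left (cohomologyEquiv_mayerVietorisδ θ θ' hS x))
    exact (map_eq_zero_iff _ (cohomologyEquiv θ' _).injective).symm
  · constructor
    · rintro ⟨p, hp⟩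
      refine ⟨(cohomologyProdEquiv U₁ U₂ θ).symm p, (cohomologyEquiv θ _).injective ?_⟩
      rw [← homologyMap_g_cohomologyProdEquiv, AddEquiv.apply_symm_apply]
      exact hp
    · rintro ⟨p, rfl⟩
      exact ⟨cohomologyProdEquiv U₁ U₂ θ p, homologyMap_g_cohomologyProdEquiv U₁ U₂ θ p⟩

theorem exact_mayerVietorisδ_mayerVietorisRestrict :
    Function.Exact (mayerVietorisδ θ θ' hS).hom (mayerVietorisRestrict X A (q + 1) U₁ U₂) := by
  intro x
  have h := (ShortComplex.ab_exact_iff_function_exact _).1 (hS.homology_exact₁ q (q + 1) rfl)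
    (cohomologyEquiv θ' Set.univ x)
  refine Iff.trans ?_ (h.trans ?_)
  · refine Iff.trans ?_ (Eq.congr_left (homologyMap_f_cohomologyEquiv U₁ U₂ θ' x).symm)
    exact (map_eq_zero_iff _ (cohomologyProdEquiv U₁ U₂ θ').injective).symm
  · constructor
    · rintro ⟨p, hp⟩
      refine ⟨(cohomologyEquiv θ _).symm p, (cohomologyEquiv θ' _).injective ?_⟩
      refine (cohomologyEquiv_mayerVietorisδ θ θ' hS _).trans (Eq.trans ?_ hp)
      exact congrArg _ ((cohomologyEquiv θ _).apply_symm_apply p)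
    · rintro ⟨p, rfl⟩
      exact ⟨cohomologyEquiv θ _ p, (cohomologyEquiv_mayerVietorisδ θ θ' hS p).symm⟩

end LongExactSequence

/-! ### Intrinsic cohomology of a subset -/

section Subspace

variable {Y Z : Type u} [MetricSpace Y] [MetricSpace Z] (A : Type u) [AddCommGroup A]

/-- The cochain map induced by an isometry. -/
def coarseCochainComplexMap {f : Z → Y} (hf : Isometry f) :
    coarseCochainComplex Y A ⟶ coarseCochainComplex Z A where
  f q := AddCommGrpCat.ofHom (coarseCochainsMap (pullbackFun f q) (pullbackFun_mem_blocky f q)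
    (pullbackFun_mem_cocontrolled hf q))
  comm' := by
    rintro i _ rfl
    simp only [coarseCochainComplex, CochainComplex.of_d]
    ext φ
    rfl

/-- Isometric spaces have isomorphic complexes of blocky cochains. -/
def coarseCochainComplexIso (e : Z ≃ᵢ Y) : coarseCochainComplex Y A ≅ coarseCochainComplex Z A where
  hom := coarseCochainComplexMap A e.isometry
  inv := coarseCochainComplexMap A e.symm.isometry
  hom_inv_id := by
    ext q φ
    obtain ⟨⟨φ, hφ⟩, rfl⟩ := QuotientAddGroup.mk_surjective φ
    refine congrArg (QuotientAddGroup.mk (s := (cocontrolledCochains Y A q).addSubgroupOf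
      (blockyCochains Y A q))) (Subtype.ext (funext fun x => ?_))
    exact congrArg φ (funext fun j => e.apply_symm_apply (x j))
  inv_hom_id := by
    ext q φ
    obtain ⟨⟨φ, hφ⟩, rfl⟩ := QuotientAddGroup.mk_surjective φ
    refine congrArg (QuotientAddGroup.mk (s := (cocontrolledCochains Z A q).addSubgroupOf
      (blockyCochains Z A q))) (Subtype.ext (funext fun x => ?_))
    exact congrArg φ (funext fun j => e.symm_apply_apply (x j))

/-- The cohomology of a subset agrees with that of the subset as a metric space. -/
theorem nonempty_cohomology_iso_subspace {X : Type u} [MetricSpace X] (q : ℕ) (U : Set X) :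
    Nonempty ((coarseSheafCohomology X A q).obj (op U) ≅
      (coarseSheafCohomology (↥U) A q).obj (op Set.univ)) := by
  obtain ⟨θ⟩ := nonempty_iso_sheafCohomology X A q
  obtain ⟨η⟩ := nonempty_iso_sheafCohomology U A q
  -- Cochains of `U` depend only on its metric, so both sides reduce to the cochains of isometric
  -- spaces: `U` and the full subset of `U`.
  let e : (Set.univ : Set U) ≃ᵢ U := ⟨Equiv.Set.univ U, fun _ _ => rfl⟩
  exact ⟨θ.app (op U) ≪≫ (HomologicalComplex.homologyFunctor _ _ q).mapIso
    (coarseCochainComplexIso A e) ≪≫ (η.app (op Set.univ)).symm⟩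

end Subspace

end CoarseMV

theorem mainTheorem8 (X : Type u) [MetricSpace X] (A : Type u) [AddCommGroup A]
    (U₁ U₂ : Set X) (hU : CoarseMV.IsCoarseCover Set.univ ![U₁, U₂]) :
    -- the cochain groups form flabby sheaves on the coarse site of `X`
    (∀ q : ℕ,
      Presheaf.IsSheaf (CoarseMV.coarseTopology X)
        (CoarseMV.coarseCochainPresheaf X A ⋙ HomologicalComplex.eval _ _ q) ∧
      ∀ (U V : Set X) (h : U ⊆ V), Function.Surjective
        (((CoarseMV.coarseCochainPresheaf X A).map (homOfLE h).op).f q).hom) ∧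
    -- coarse sheaf cohomology of a subset is that of the subset as a metric space in its own right
    (∀ (q : ℕ) (U : Set X), Nonempty
      ((CoarseMV.coarseSheafCohomology X A q).obj (op U) ≅
        (CoarseMV.coarseSheafCohomology (↥U) A q).obj (op Set.univ))) ∧
    -- the cochain sequence is short exact
    ∃ (hS : (CoarseMV.mayerVietorisShortComplex X A U₁ U₂).ShortExact)
      -- natural isomorphisms from sheaf cohomology to the cohomology of the cochain complexes
      (Θ : ∀ q : ℕ, CoarseMV.coarseSheafCohomology X A q ≅
        CoarseMV.coarseCochainPresheaf X A ⋙ HomologicalComplex.homologyFunctor _ _ q)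
      -- the connecting homomorphisms
      (δ : ∀ q : ℕ, (CoarseMV.coarseSheafCohomology X A q).obj (op (U₁ ∩ U₂)) ⟶
        (CoarseMV.coarseSheafCohomology X A (q + 1)).obj (op Set.univ)),
      -- exactness of the long sequence
      Function.Injective (CoarseMV.mayerVietorisRestrict X A 0 U₁ U₂) ∧
      (∀ q : ℕ, Function.Exact (CoarseMV.mayerVietorisRestrict X A q U₁ U₂)
        (CoarseMV.mayerVietorisDiff X A q U₁ U₂)) ∧
      (∀ q : ℕ, Function.Exact (CoarseMV.mayerVietorisDiff X A q U₁ U₂) (δ q).hom) ∧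
      (∀ q : ℕ, Function.Exact (δ q).hom
        (CoarseMV.mayerVietorisRestrict X A (q + 1) U₁ U₂)) ∧
      -- it is the long exact cohomology sequence of the short exact cochain sequence
      (∀ q : ℕ, δ q ≫ (Θ (q + 1)).hom.app (op Set.univ) =
        (Θ q).hom.app (op (U₁ ∩ U₂)) ≫ hS.δ q (q + 1) rfl) := by
  refine ⟨fun q => ⟨(CoarseMV.hasCoarseGluing_cochainPresheaf q).isSheaf,
    fun U V h => CoarseMV.isFlabby_cochainPresheaf q h⟩,
    fun q U => CoarseMV.nonempty_cohomology_iso_subspace A q U, ?_⟩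
  have hS := CoarseMV.shortExact_mayerVietorisShortComplex A hU
  -- Any choice works, because the connecting maps are defined by transport along it.
  let Θ q := (CoarseMV.nonempty_iso_sheafCohomology X A q).some
  exact ⟨hS, Θ, fun q => CoarseMV.mayerVietorisδ (Θ q) (Θ (q + 1)) hS,
    CoarseMV.mayerVietorisRestrict_zero_injective U₁ U₂ (Θ 0) hS,
    fun q => CoarseMV.exact_mayerVietorisRestrict_mayerVietorisDiff U₁ U₂ (Θ q) hS,
    fun q => CoarseMV.exact_mayerVietorisDiff_mayerVietorisδ (Θ q) (Θ (q + 1)) hS,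
    fun q => CoarseMV.exact_mayerVietorisδ_mayerVietorisRestrict (Θ q) (Θ (q + 1)) hS,
    fun q => CoarseMV.mayerVietorisδ_comp (Θ q) (Θ (q + 1)) hS⟩
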